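/- **Setting.** Let $\mathbf K$ be an ordered field and let $\mathfrak M,\mathfrak N$ be non-trivial linearly ordered Abelian groups (written multiplicatively, with ordering $\prec$). Write $\mathbb S=\mathbf K[[\mathfrak M]]$ and $\mathbb T=\mathbf K[[\mathfrak N]]$ for the fields of formal series $s=\sum_{\mathfrak m}s(\mathfrak m)\mathfrak m$ whose support $\operatorname{supp}s$ is reverse well-ordered. Such a field is ordered: a non-zero series is positive if its leading coefficient (that of the largest monomial of its support) is positive. It also carries a dominance relation: $s\prec t$ if $t\ne0$ and every monomial of $\operatorname{supp} s$ is smaller than some monomial of $\operatorname{supp} t$; $s\preccurlyeq t$ if $t\not\prec s$; and $s\asymp t$ if $s\preccurlyeq t\preccurlyeq s$. A family $(s_i)_{i\in I}$ is summable if $\bigcup_i\operatorname{supp}s_i$ is reverse well-ordered and each monomial lies in $\operatorname{supp}s_i$ for only finitely many $i$; then $\sum_i s_i$ is the coefficientwise sum. A $\mathbf K$-linear map is strongly linear if it maps summable families to summable families and commutes with their sums. Let $\ell:(\mathfrak M,\cdot,\prec)\to(\mathbb S,+,<)$ be an embedding of ordered groups and let $\partial:\mathbb S\to\mathbb S$,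 $s\mapsto s'$, be a strongly linear derivation with $\partial(\ell(\mathfrak m))=\mathfrak m^\dagger:=\mathfrak m'/\mathfrak m$ for all $\mathfrak m\in\mathfrak M$. Let $\triangle:\mathbb S\to\mathbb T$ be a strongly linear morphism of ordered rings. Let $x\in\mathbb S\setminus\{0\}$ be such that for every $\mathfrak m\in\mathfrak M$, either $\mathfrak m^\dagger\preccurlyeq x^{-1}$ and $\mathfrak n^\dagger\preccurlyeq x^{-1}$ for all $\mathfrak n\in\operatorname{supp}\mathfrak m'$, or $\mathfrak m^\dagger\succ x^{-1}$ and $\mathfrak n^\dagger\asymp\mathfrak m^\dagger$ for all $\mathfrak n\in\operatorname{supp}\mathfrak m'$. Let $\delta\in\mathbb T$ with $\delta\prec\triangle(x)$. Put $$\mathfrak M_{\triangle,\delta}=\{\mathfrak m\in\mathfrak M:\triangle(\mathfrak m^\dagger)\,\delta\prec1\},\qquad \mathbb S_{\triangle,\delta}=\mathbf K[[\mathfrak M_{\triangle,\delta}]]\subseteq\mathbb S,\qquad T_\delta(\triangle)(s)=\sum_{k\in\mathbb N}\frac{\triangle(s^{(k)})}{k!}\,\delta^k,$$ where $s^{(k)}=\partial^k(s)$;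 $\mathfrak M_{\triangle,\delta}$ is a subgroup of $\mathfrak M$, and $T_\delta(\triangle)(s)$ is defined if the family of terms is summable. **Analytic functions.** Let $\mathbb F$ be $\mathbb S_{\triangle,\delta}$ or $\mathbb T$, and $\mathbb F^{>}$ its set of positive elements. A power series $P=\sum_k P_kX^k$ over $\mathbb F$ converges at $\varepsilon\in\mathbb F$ if $(P_k\varepsilon^k)_k$ is summable, and then $\tilde P(\varepsilon)$ denotes the sum. A function $f:\mathbb F^{>}\to\mathbb F$ is analytic if for each $s\in\mathbb F^{>}$ there are a power series $f_s$ (the Taylor series of $f$ at $s$) and a $\rho\ne0$ at which $f_s$ converges such that $f(s+\varepsilon)=\tilde f_s(\varepsilon)$ for all $\varepsilon\preccurlyeq\rho$ with $s+\varepsilon\in\mathbb F^{>}$. Then $\operatorname{Conv}(f)_s$ is the set of all $t\in\mathbb F^{>}$ such that $f_s$ converges at $t-s$ and $f(t)=\tilde f_s(t-s)$, and $f'$ is the derivative of $f$ for the valuation topology. Write $\mathbb F^{\prec s}=\{\varepsilon\in\mathbb F:\varepsilon\prec s\}$. **Theorem.** 1. Let $\mathcal A_{\mathbb S}$ and $\mathcal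 A_{\mathbb T}$ be sets of analytic functions $\mathbb S_{\triangle,\delta}^{>}\to\mathbb S_{\triangle,\delta}$ and $\mathbb T^{>}\to\mathbb T$ respectively, each closed under $f\mapsto f'$, with $\operatorname{Conv}(f)_s\supseteq s+\mathbb S_{\triangle,\delta}^{\prec s}$ and $\operatorname{Conv}(g)_t\supseteq t+\mathbb T^{\prec t}$ for all $f\in\mathcal A_{\mathbb S}$, $g\in\mathcal A_{\mathbb T}$, $s\in\mathbb S_{\triangle,\delta}^{>}$, $t\in\mathbb T^{>}$. Let $\Psi:\mathcal A_{\mathbb S}\to\mathcal A_{\mathbb T}$ be a map with $\Psi(f')=\Psi(f)'$ for all $f\in\mathcal A_{\mathbb S}$, and suppose that $$\triangle(f(s))=\Psi(f)(\triangle(s))\quad\text{and}\quad\partial(f(s))=\partial(s)\,f'(s)$$ for all $f\in\mathcal A_{\mathbb S}$ and $s\in\mathbb S_{\triangle,\delta}^{>}$. Then for all $f\in\mathcal A_{\mathbb S}$ and $s\in\mathbb S_{\triangle,\delta}^{>}$, both $T_\delta(\triangle)(s)$ and $T_\delta(\triangle)(f(s))$ are defined, $T_\delta(\triangle)(s)>0$,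 and $$T_\delta(\triangle)(f(s))=\Psi(f)\bigl(T_\delta(\triangle)(s)\bigr).$$ 2. In particular, Taylor deformations of log-compatible maps are log-compatible: let $\log_{\mathbf K}:(\mathbf K^{>},\cdot,<)\to(\mathbf K,+,<)$ and $\ell_{\mathbb T}:(\mathfrak N,\cdot,\prec)\to(\mathbb T,+,<)$ be embeddings of ordered groups, and extend $\ell$ and $\ell_{\mathbb T}$ to logarithms on $\mathbb S^{>}$ and $\mathbb T^{>}$ by $$\log\bigl(c\,\mathfrak m(1+\varepsilon)\bigr)=\ell(\mathfrak m)+\log_{\mathbf K}(c)+\sum_{k\ge1}\frac{(-1)^{k-1}}{k}\varepsilon^k\qquad(c\in\mathbf K^{>},\ \mathfrak m \text{ a monomial},\ \varepsilon\prec1)$$ (with $\ell_{\mathbb T}$ in place of $\ell$ on $\mathbb T^{>}$). If $\log(\mathbb S_{\triangle,\delta}^{>})\subseteq\mathbb S_{\triangle,\delta}$ and $\triangle(\log s)=\log\triangle(s)$ for all $s\in\mathbb S_{\triangle,\delta}^{>}$, then for all $s\in\mathbb S_{\triangle,\delta}^{>}$, both $T_\delta(\triangle)(s)$ and $T_\delta(\triangle)(\log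 s)$ are defined, $T_\delta(\triangle)(s)>0$, and $T_\delta(\triangle)(\log s)=\log T_\delta(\triangle)(s)$. -/

import Mathlib

/-!
Conventions. A linearly ordered Abelian group `𝔐` of monomials (written multiplicatively, with
strict ordering `≺`) is given by its additive value group `Γ` with the reversed ordering: `γ : Γ`
stands for a monomial `𝔪 γ`, with `𝔪 (γ + γ') = 𝔪 γ * 𝔪 γ'`, and `𝔪 γ ≺ 𝔪 γ'` means `γ' < γ`.
The field `K⟦𝔐⟧` of Noetherian (well-based) series is Mathlib's `HahnSeries Γ K`.
-/

universe u u' v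

noncomputable section

namespace TaylorDef

/-! ### Series: monomials, dominance, positivity, summation -/

section Series

variable {Γ : Type u} [AddCommGroup Γ] [LinearOrder Γ] [IsOrderedAddMonoid Γ]
  {K : Type v} [Field K]

/-- The monomial `𝔪 γ`, as a series. -/
def mono (K : Type v) [Field K] (γ : Γ) : HahnSeries Γ K := HahnSeries.single γ 1

/-- `s ≼ t`. -/
def Dominated (s t : HahnSeries Γ K) : Prop := t.orderTop ≤ s.orderTop

/-- `s ≺ t`. -/
def StrictlyDominated (s t : HahnSeries Γ K) : Prop := t.orderTop < s.orderTop

/-- `s ≍ t`. -/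
def SameDominance (s t : HahnSeries Γ K) : Prop := Dominated s t ∧ Dominated t s

/-- Summability of a family: the union of the supports is Noetherian, and each monomial lies in
only finitely many of the supports. -/
def IsSummable {ι : Type*} (s : ι → HahnSeries Γ K) : Prop :=
  (⋃ i, (s i).support).IsPWO ∧ ∀ γ : Γ, {i | (s i).coeff γ ≠ 0}.Finite

open scoped Classical in
/-- The sum of a summable family (`0` if the family is not summable). -/
def seriesSum {ι : Type*} (s : ι → HahnSeries Γ K) : HahnSeries Γ K :=
  if h : IsSummable s then
    (HahnSeries.SummableFamily.mk s h.1 h.2 : HahnSeries.SummableFamily Γ K ι).hsum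
  else 0

/-- The set of positive series: the leading coefficient (which is `0` for the zero series)
is positive. -/
def positive (Γ : Type u) [AddCommGroup Γ] [LinearOrder Γ] [IsOrderedAddMonoid Γ]
    (K : Type v) [Field K] [LinearOrder K] : Set (HahnSeries Γ K) :=
  {s | 0 < s.leadingCoeff}

/-- A function between fields of series is strongly linear if it is `K`-linear and commutes with
the sums of summable families. It suffices to consider index sets in the universe of `Γ`, since
the non-zero members of a summable family can be indexed by a subset of `Γ × ℕ`. -/
structure IsStronglyLinear {Γ' : Type u'} [AddCommGroup Γ'] [LinearOrder Γ']
    [IsOrderedAddMonoid Γ'] (Φ : HahnSeries Γ K → HahnSeries Γ' K) : Prop where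
  isLinear : IsLinearMap K Φ
  map_sum : ∀ (ι : Type u) (s : ι → HahnSeries Γ K), IsSummable s →
    IsSummable (fun i => Φ (s i)) ∧ Φ (seriesSum s) = seriesSum (fun i => Φ (s i))

end Series

/-! ### Power series and analytic functions on a field of series -/

section Analysis

variable {Γ : Type u} [AddCommGroup Γ] [LinearOrder Γ] [IsOrderedAddMonoid Γ]
  {K : Type v} [Field K]

/-- The locus of convergence `Conv P` of a power series. -/
def convergenceSet (P : PowerSeries (HahnSeries Γ K)) : Set (HahnSeries Γ K) :=
  {ε | IsSummable (fun k : ℕ => PowerSeries.coeff k P * ε ^ k)}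

/-- The value `∑ₖ Pₖ εᵏ` of a power series at a point of its locus of convergence. -/
def evalSeries (P : PowerSeries (HahnSeries Γ K)) (ε : HahnSeries Γ K) : HahnSeries Γ K :=
  seriesSum (fun k : ℕ => PowerSeries.coeff k P * ε ^ k)

variable {O : Set (HahnSeries Γ K)}

/-- `P` is a Taylor series of `f : O → K⟦𝔐⟧` at `s ∈ O`. -/
def IsTaylorSeriesAt (f : O → HahnSeries Γ K) (s : O) (P : PowerSeries (HahnSeries Γ K)) : Prop :=
  ∃ ρ ∈ convergenceSet P, ρ ≠ 0 ∧ ∀ ε, Dominated ε ρ →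
    ∀ h : (s : HahnSeries Γ K) + ε ∈ O, f ⟨s + ε, h⟩ = evalSeries P ε

/-- `f` is analytic on `O`: it has a Taylor series at each point of `O`. -/
def IsAnalytic (f : O → HahnSeries Γ K) : Prop :=
  ∀ s : O, ∃ P, IsTaylorSeriesAt f s P

/-- The set `Conv(f)_s` of all `t ∈ O` such that the Taylor series of `f` at `s` converges
at `t - s` with value `f t`. -/
def taylorConv (f : O → HahnSeries Γ K) (s : O) : Set (HahnSeries Γ K) :=
  {t | ∃ P, IsTaylorSeriesAt f s P ∧ t - s ∈ convergenceSet P ∧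
    ∃ h : t ∈ O, f ⟨t, h⟩ = evalSeries P (t - s)}

/-- `l` is the derivative of `f` at `s` for the valuation topology, i.e. the limit of
`(f y - f s) / (y - s)` as `y` tends to `s`. -/
def HasDerivativeAt (f : O → HahnSeries Γ K) (s : O) (l : HahnSeries Γ K) : Prop :=
  ∀ ε : HahnSeries Γ K, ε ≠ 0 → ∃ ρ : HahnSeries Γ K, ρ ≠ 0 ∧ ∀ y : O,
    Dominated ((y : HahnSeries Γ K) - (s : HahnSeries Γ K)) ρ →
      Dominated (f y - f s - ((y : HahnSeries Γ K) - (s : HahnSeries Γ K)) * l)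
        (((y : HahnSeries Γ K) - (s : HahnSeries Γ K)) * ε)

/-- `f'` is the derivative of `f` on `O`. -/
def IsDerivativeOf (f' f : O → HahnSeries Γ K) : Prop :=
  ∀ s : O, HasDerivativeAt f s (f' s)

/-- A set `A` of analytic functions on `O` containing the derivative of each of its members. -/
structure IsDerivClosedAnalyticClass (A : Set (O → HahnSeries Γ K)) : Prop where
  analytic : ∀ f ∈ A, IsAnalytic f
  deriv_mem : ∀ f ∈ A, ∃ f' ∈ A, IsDerivativeOf f' f

/-- For every `f ∈ A` and `s ∈ O`, the Taylor series of `f` at `s` converges to `f` on the set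
of all `t` with `t - s ≺ s`. -/
def HasLargeConvergence (A : Set (O → HahnSeries Γ K)) : Prop :=
  ∀ f ∈ A, ∀ s : O, {t | StrictlyDominated (t - (s : HahnSeries Γ K)) (s : HahnSeries Γ K)} ⊆ taylorConv f s

end Analysis

/-! ### Pre-logarithmic and differential pre-logarithmic Hahn fields -/

section LogDer

variable {Γ : Type u} [AddCommGroup Γ] [LinearOrder Γ] [IsOrderedAddMonoid Γ]
  {K : Type v} [Field K]

/-- The logarithmic derivative `𝔪† = ∂ 𝔪 / 𝔪` of the monomial `𝔪 = 𝔪 γ`. -/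
def logDer (D : Derivation K (HahnSeries Γ K) (HahnSeries Γ K)) (γ : Γ) : HahnSeries Γ K :=
  D (mono K γ) / mono K γ

theorem logDer_zero (D : Derivation K (HahnSeries Γ K) (HahnSeries Γ K)) :
    logDer D (0 : Γ) = 0 := by
  have h : mono K (0 : Γ) = 1 := rfl
  simp [logDer, h]

theorem logDer_add (D : Derivation K (HahnSeries Γ K) (HahnSeries Γ K)) (a b : Γ) :
    logDer D (a + b) = logDer D a + logDer D b := by
  have h : mono K (a + b) = mono K a * mono K b := by simp [mono]
  have ha : mono K a ≠ 0 := by simp [mono]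
  have hb : mono K b ≠ 0 := by simp [mono]
  simp only [logDer, h, Derivation.leibniz, smul_eq_mul]
  field_simp
  ring

theorem logDer_neg (D : Derivation K (HahnSeries Γ K) (HahnSeries Γ K)) (a : Γ) :
    logDer D (-a) = -logDer D a := by
  have h := logDer_add D a (-a)
  rw [add_neg_cancel, logDer_zero] at h
  exact (neg_eq_of_add_eq_zero_right h.symm).symm

end LogDer

section PreLog

variable {Γ : Type u} [AddCommGroup Γ] [LinearOrder Γ] [IsOrderedAddMonoid Γ]
  {K : Type v} [Field K] [LinearOrder K]

/-- `ℓ` is an embedding of ordered groups `(𝔐, ·, ≺) → (K⟦𝔐⟧, +, <)`. -/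
def IsPreLog (ℓ : Γ →+ HahnSeries Γ K) : Prop :=
  ∀ γ γ' : Γ, γ' < γ ↔ ℓ γ' - ℓ γ ∈ positive Γ K

/-- `(K⟦𝔐⟧, ℓ, ∂)` is a differential pre-logarithmic Hahn field. -/
structure IsDiffPreLogHahnField (ℓ : Γ →+ HahnSeries Γ K)
    (D : Derivation K (HahnSeries Γ K) (HahnSeries Γ K)) : Prop where
  preLog : IsPreLog ℓ
  stronglyLinear : IsStronglyLinear (fun s => D s)
  der_log : ∀ γ : Γ, D (ℓ γ) = logDer D γ

/-- For every monomial `𝔪`, either `𝔪† ≼ x⁻¹` and `𝔫† ≼ x⁻¹` for all `𝔫 ∈ supp (∂ 𝔪)`,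
or `𝔪† ≻ x⁻¹` and `𝔫† ≍ 𝔪†` for all `𝔫 ∈ supp (∂ 𝔪)`. -/
def SpecialCondition (D : Derivation K (HahnSeries Γ K) (HahnSeries Γ K))
    (x : HahnSeries Γ K) : Prop :=
  ∀ γ : Γ,
    (Dominated (logDer D γ) x⁻¹ ∧
      ∀ β ∈ (D (mono K γ)).support, Dominated (logDer D β) x⁻¹) ∨
    (StrictlyDominated x⁻¹ (logDer D γ) ∧
      ∀ β ∈ (D (mono K γ)).support, SameDominance (logDer D β) (logDer D γ))

/-- The extension of `ℓ` and of a logarithm on the positive elements of `K` to the positive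
series: `log (c 𝔪 (1 + ε)) = ℓ 𝔪 + log c + ∑_{k ≥ 1} (-1)^(k-1) ε^k / k`
for `c > 0` in `K`, a monomial `𝔪`, and `ε ≺ 1`. -/
def hahnLog (logK : K → K) (ℓ : Γ →+ HahnSeries Γ K) (s : HahnSeries Γ K) : HahnSeries Γ K :=
  ℓ s.order + HahnSeries.C (logK s.leadingCoeff) +
    seriesSum (fun k : ℕ => ((-1) ^ k / ((k : K) + 1)) •
      (s / HahnSeries.single s.order s.leadingCoeff - 1) ^ (k + 1))

/-- `logK` restricts to an embedding of ordered groups `(K^{>0}, ·, <) → (K, +, <)`. -/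
structure IsLogOn (logK : K → K) : Prop where
  map_mul : ∀ a b : K, 0 < a → 0 < b → logK (a * b) = logK a + logK b
  strictMono : ∀ a b : K, 0 < a → 0 < b → (a < b ↔ logK a < logK b)

end PreLog

/-! ### Taylor deformations -/

section Taylor

variable {Γ : Type u} [AddCommGroup Γ] [LinearOrder Γ] [IsOrderedAddMonoid Γ]
  {Γ' : Type u'} [AddCommGroup Γ'] [LinearOrder Γ'] [IsOrderedAddMonoid Γ']
  {K : Type v} [Field K]

/-- A strongly linear morphism of ordered rings. -/
structure IsStrongOrderedMorphism [LinearOrder K] (Δ : HahnSeries Γ K →ₐ[K] HahnSeries Γ' K) : Prop where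
  stronglyLinear : IsStronglyLinear (fun s => Δ s)
  pos : ∀ s ∈ positive Γ K, Δ s ∈ positive Γ' K


/-- The group of (value group elements of) monomials `𝔪` with `Δ (𝔪†) δ ≺ 1`. -/
def taylorGroup (D : Derivation K (HahnSeries Γ K) (HahnSeries Γ K))
    (Δ : HahnSeries Γ K →ₐ[K] HahnSeries Γ' K) (δ : HahnSeries Γ' K) : AddSubgroup Γ where
  carrier := {γ | StrictlyDominated (Δ (logDer D γ) * δ) 1}
  zero_mem' := by
    simp [logDer_zero, StrictlyDominated]
  add_mem' := by
    intro a b ha hb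
    simp only [Set.mem_ofPred_eq, StrictlyDominated] at *
    rw [logDer_add, map_add, add_mul]
    exact lt_of_lt_of_le (lt_min ha hb) HahnSeries.min_orderTop_le_orderTop_add
  neg_mem' := by
    intro a ha
    simp only [Set.mem_ofPred_eq, StrictlyDominated] at *
    rwa [logDer_neg, map_neg, neg_mul, HahnSeries.orderTop_neg]

/-- The field `K⟦𝔐_{Δ,δ}⟧` of series whose monomials lie in the group `taylorGroup D Δ δ`. -/
abbrev TaylorField (D : Derivation K (HahnSeries Γ K) (HahnSeries Γ K))
    (Δ : HahnSeries Γ K →ₐ[K] HahnSeries Γ' K) (δ : HahnSeries Γ' K) : Type (max u v) :=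
  HahnSeries (taylorGroup D Δ δ) K

/-- The inclusion of `K⟦𝔊⟧` into `K⟦𝔐⟧` for a subgroup `𝔊` of `𝔐`. -/
def incl {H : AddSubgroup Γ} : HahnSeries H K →+* HahnSeries Γ K :=
  HahnSeries.embDomainRingHom H.subtype Subtype.coe_injective (fun _ _ => Iff.rfl)

/-- The `k`-th term `Δ (s⁽ᵏ⁾) δᵏ / k!` of the Taylor expansion at `s`. -/
def taylorTerm (D : Derivation K (HahnSeries Γ K) (HahnSeries Γ K))
    (Δ : HahnSeries Γ K →ₐ[K] HahnSeries Γ' K) (δ : HahnSeries Γ' K)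
    (s : HahnSeries Γ K) (k : ℕ) : HahnSeries Γ' K :=
  ((k.factorial : K)⁻¹) • (Δ ((fun t => D t)^[k] s) * δ ^ k)

/-- The Taylor deformation of `Δ`, a partial map: it is defined at `s` if the family
`taylorTerm D Δ δ s` is summable. -/
def taylorDeformation (D : Derivation K (HahnSeries Γ K) (HahnSeries Γ K))
    (Δ : HahnSeries Γ K →ₐ[K] HahnSeries Γ' K) (δ : HahnSeries Γ' K)
    (s : HahnSeries Γ K) : HahnSeries Γ' K :=
  seriesSum (taylorTerm D Δ δ s)

end Taylor

end TaylorDef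

end

set_option linter.unusedSectionVars false

noncomputable section

namespace TaylorDef

/-! ### Sequences in linear orders and well-ordered sets -/

section Sequences

variable {α : Type*} [LinearOrder α]

/-! The two main points are the summability of the Taylor expansion and the identification of its
sum by formal substitution of power series.

Summability. Attach to a monomial 𝔪 a monomial 𝔟 (with value `growth`): 𝔟 ≍ x if 𝔪† ≼ x⁻¹, and 𝔟⁻¹ ≍
𝔪† otherwise. The special condition says that 𝔟 is constant along any chain in which each monomial
lies in the support of the derivative of the previous one. A monomial 𝔫 of s⁽ᵏ⁾ ends such a chain of
k steps starting in supp s, each step multiplying by something ≼ 𝔟⁻¹. Write Δ(𝔫)δᵏ =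
Δ(𝔫𝔟ᵏ)(Δ(𝔟⁻¹)δ)ᵏ. The second factor is a power of an infinitesimal, because δ ≺ Δ(x) and 𝔪 ∈
𝔐_{Δ,δ}. So for a fixed 𝔟 it is enough that the monomials 𝔫𝔟ᵏ be well-based, which is a
Nash-Williams minimal bad sequence argument (`Reaches.not_strictAnti`). When 𝔟 varies over a
sequence, pass to a subsequence of values. If these do not increase, the first 𝔟 serves for all
terms. If they strictly increase, `exists_monotone_of_strictMono` still produces one 𝔟 that serves
for a tail; otherwise one could build a well-based sequence of monomials whose derivatives form a
non-summable family.

Commutation. The formal series ∑ Δ(s⁽ᵏ⁾)δᵏ/k! Xᵏ is multiplicative in s. If a₀, a₁, … satisfy aₙ' =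
s'aₙ₊₁, comparison of formal derivatives shows that the series of a₀ is ∑ Δ(aⱼ)/j! Yʲ with Y the
series of s minus Δ(s). Summing the coefficients, that is putting X = 1, is legitimate because all
terms with k ≥ 1 are dominated by one w ≺ Δ(s) at which the outer series converges
(`evalSeries_seriesSum`). For aⱼ = f⁽ʲ⁾(s) the outer series is the Taylor series of Ψ(f) at Δ(s),
since Taylor coefficients are determined by iterated derivatives. For the logarithm the aⱼ are
explicit, and the outer series is summed by the functional equation of log(1 + X). Positivity
follows from T(s) − Δ(s) ≺ Δ(s). -/

theorem exists_strictMono_or_antitone (f : ℕ → α) :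
    ∃ g : ℕ → ℕ, StrictMono g ∧ (StrictMono (f ∘ g) ∨ Antitone (f ∘ g)) := by
  obtain ⟨g, hg | hg⟩ := exists_increasing_or_nonincreasing_subseq (· < ·) f
  · exact ⟨g, g.strictMono, Or.inl fun m n h => hg m n h⟩
  · refine ⟨g, g.strictMono, Or.inr fun m n h => ?_⟩
    rcases h.eq_or_lt with rfl | h
    · exact le_rfl
    · exact not_lt.1 (hg m n h)

theorem exists_monotone_or_strictAnti (f : ℕ → α) :
    ∃ g : ℕ → ℕ, StrictMono g ∧ (Monotone (f ∘ g) ∨ StrictAnti (f ∘ g)) := by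
  obtain ⟨g, hg, h | h⟩ := exists_strictMono_or_antitone (α := αᵒᵈ) f
  · exact ⟨g, hg, Or.inr h⟩
  · exact ⟨g, hg, Or.inl h⟩

theorem not_strictAnti_of_isPWO {s : Set α} (hs : s.IsPWO) {f : ℕ → α} (hf : ∀ n, f n ∈ s) :
    ¬ StrictAnti f :=
  fun h => Set.isWF_iff_no_descending_seq.1 hs.isWF f h hf

theorem isPWO_of_forall_not_strictAnti {s : Set α}
    (hs : ∀ f : ℕ → α, StrictAnti f → ¬ ∀ n, f n ∈ s) : s.IsPWO :=
  Set.isPWO_iff_isWF.2 (Set.isWF_iff_no_descending_seq.2 hs)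

theorem exists_strictMono_of_infinite {p : ℕ → Prop} (h : {n | p n}.Infinite) :
    ∃ g : ℕ → ℕ, StrictMono g ∧ ∀ n, p (g n) :=
  ⟨Nat.nth p, Nat.nth_strictMono h, fun n => Nat.nth_mem_of_infinite h n⟩

end Sequences

/-! ### Summable families -/

section Summable

variable {Γ : Type u} [AddCommGroup Γ] [LinearOrder Γ] [IsOrderedAddMonoid Γ]
  {K : Type v} [Field K] {ι κ : Type*}

theorem isSummable_coe (F : HahnSeries.SummableFamily Γ K ι) : IsSummable F :=
  ⟨F.isPWO_iUnion_support, F.finite_co_support⟩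

theorem seriesSum_coe (F : HahnSeries.SummableFamily Γ K ι) : seriesSum F = F.hsum :=
  dif_pos (isSummable_coe F)

/-- A summable family as a bundled `HahnSeries.SummableFamily`. -/
def IsSummable.family {s : ι → HahnSeries Γ K} (h : IsSummable s) :
    HahnSeries.SummableFamily Γ K ι := ⟨s, h.1, h.2⟩

theorem IsSummable.hsum_family {s : ι → HahnSeries Γ K} (h : IsSummable s) :
    h.family.hsum = seriesSum s :=
  (seriesSum_coe h.family).symm

theorem IsSummable.coeff_seriesSum {s : ι → HahnSeries Γ K} (h : IsSummable s) (γ : Γ) :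
    (seriesSum s).coeff γ = ∑ᶠ i, (s i).coeff γ := by
  rw [← h.hsum_family, HahnSeries.SummableFamily.coeff_hsum]; rfl

/-- A well-ordered set of values admits only eventually repeating antitone sequences, so along a
subsequence a single monomial would lie in infinitely many supports. -/
theorem IsSummable.not_antitone {s : ι → HahnSeries Γ K} (h : IsSummable s) {i : ℕ → ι}
    (hi : Function.Injective i) {g : ℕ → Γ} (hg : Antitone g)
    (hmem : ∀ m, g m ∈ (s (i m)).support) : False := by
  obtain ⟨φ, hφ⟩ := h.1.exists_monotone_subseq (f := g)
    fun n => Set.mem_iUnion.2 ⟨i n, hmem n⟩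
  have hc : ∀ n, g (φ n) = g (φ 0) := fun n =>
    le_antisymm (hg (φ.monotone (Nat.zero_le n))) (hφ (Nat.zero_le n))
  refine Set.infinite_range_of_injective (hi.comp φ.injective) ((h.2 (g (φ 0))).subset ?_)
  rintro _ ⟨n, rfl⟩
  have := hmem (φ n)
  rw [hc] at this
  exact this

/-- The converse criterion: both clauses of summability reduce to excluding one antitone sequence of
values with strictly increasing indices. -/
theorem isSummable_of_not_antitone {s : ℕ → HahnSeries Γ K}
    (h : ∀ (k : ℕ → ℕ) (g : ℕ → Γ), StrictMono k → Antitone g →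
      ¬ ∀ m, g m ∈ (s (k m)).support) : IsSummable s := by
  refine ⟨isPWO_of_forall_not_strictAnti fun f hf hmem => ?_, fun γ => ?_⟩
  · choose k hk using fun n => Set.mem_iUnion.1 (hmem n)
    obtain ⟨φ, hφ, hm | hm⟩ := exists_strictMono_or_antitone k
    · exact h (k ∘ φ) (f ∘ φ) hm (hf.antitone.comp_monotone hφ.monotone) fun m => hk (φ m)
    -- Along antitone indices only finitely many members of the family occur, and a finite union of
    -- supports is well-ordered.
    · have hP : (⋃ i ∈ Finset.range (k (φ 0) + 1), (s i).support).IsPWO :=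
        (Finset.isPWO_bUnion _).2 fun i _ => (s i).isPWO_support
      refine not_strictAnti_of_isPWO hP (f := f ∘ φ) (fun n => ?_) (hf.comp_strictMono hφ)
      refine Set.mem_biUnion (x := k (φ n)) ?_ (hk (φ n))
      have : k (φ n) ≤ k (φ 0) := hm (Nat.zero_le n)
      simp only [Finset.coe_range, Set.mem_Iio]; omega
  · by_contra hinf
    obtain ⟨k, hk, hk'⟩ := exists_strictMono_of_infinite hinf
    exact h k (fun _ => γ) hk antitone_const hk'

theorem IsSummable.comp_injective {s : ι → HahnSeries Γ K} (h : IsSummable s) {f : κ → ι}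
    (hf : Function.Injective f) : IsSummable (fun k => s (f k)) := by
  refine ⟨h.1.mono (Set.iUnion_subset fun k => Set.subset_iUnion (fun i => (s i).support) (f k)),
    fun γ => ?_⟩
  exact (h.2 γ).preimage hf.injOn

theorem isSummable_comp_equiv {s : ι → HahnSeries Γ K} (e : κ ≃ ι) :
    IsSummable (fun k => s (e k)) ↔ IsSummable s := by
  refine ⟨fun h => ?_, fun h => h.comp_injective e.injective⟩
  simpa using h.comp_injective e.symm.injective

theorem seriesSum_comp_equiv (s : ι → HahnSeries Γ K) (e : κ ≃ ι) :
    seriesSum (fun k => s (e k)) = seriesSum s := by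
  by_cases h : IsSummable s
  · ext γ
    rw [h.coeff_seriesSum, ((isSummable_comp_equiv e).2 h).coeff_seriesSum]
    exact finsum_comp_equiv e (f := fun i => (s i).coeff γ)
  · rw [seriesSum, seriesSum, dif_neg h, dif_neg (mt (isSummable_comp_equiv e).1 h)]

theorem IsSummable.of_support_subset {s t : ι → HahnSeries Γ K} (h : IsSummable s)
    (hst : ∀ i, (t i).support ⊆ (s i).support) : IsSummable t :=
  ⟨h.1.mono (Set.iUnion_mono hst), fun γ => (h.2 γ).subset fun i hi => hst i hi⟩

theorem IsSummable.mul_left {s : ι → HahnSeries Γ K} (h : IsSummable s) (x : HahnSeries Γ K) :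
    IsSummable (fun i => x * s i) := by
  have : (fun i => x * s i) = ⇑(x • h.family) := by
    funext i
    rw [HahnSeries.SummableFamily.smul_apply, HahnSeries.of_symm_smul_of_eq_mul]; rfl
  rw [this]
  exact isSummable_coe _

theorem IsSummable.seriesSum_mul_left {s : ι → HahnSeries Γ K} (h : IsSummable s)
    (x : HahnSeries Γ K) : seriesSum (fun i => x * s i) = x * seriesSum s := by
  have : (fun i => x * s i) = ⇑(x • h.family) := by
    funext i
    rw [HahnSeries.SummableFamily.smul_apply, HahnSeries.of_symm_smul_of_eq_mul]; rfl
  rw [this, seriesSum_coe, HahnSeries.SummableFamily.hsum_smul, h.hsum_family]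

theorem IsSummable.mul {s : ι → HahnSeries Γ K} {t : κ → HahnSeries Γ K} (hs : IsSummable s)
    (ht : IsSummable t) : IsSummable (fun p : ι × κ => s p.1 * t p.2) :=
  isSummable_coe (HahnSeries.SummableFamily.mul hs.family ht.family)

theorem IsSummable.seriesSum_mul {s : ι → HahnSeries Γ K} {t : κ → HahnSeries Γ K}
    (hs : IsSummable s) (ht : IsSummable t) :
    seriesSum (fun p : ι × κ => s p.1 * t p.2) = seriesSum s * seriesSum t := by
  have := seriesSum_coe (HahnSeries.SummableFamily.mul hs.family ht.family)
  rw [HahnSeries.SummableFamily.hsum_mul, hs.hsum_family, ht.hsum_family] at this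
  exact this

theorem IsSummable.add {s t : ι → HahnSeries Γ K} (hs : IsSummable s) (ht : IsSummable t) :
    IsSummable (fun i => s i + t i) :=
  isSummable_coe (hs.family + ht.family)

theorem IsSummable.seriesSum_add {s t : ι → HahnSeries Γ K} (hs : IsSummable s)
    (ht : IsSummable t) : seriesSum (fun i => s i + t i) = seriesSum s + seriesSum t := by
  have := seriesSum_coe (hs.family + ht.family)
  rw [HahnSeries.SummableFamily.hsum_add, hs.hsum_family, ht.hsum_family] at this
  exact this

theorem isSummable_of_finite [Finite ι] (s : ι → HahnSeries Γ K) : IsSummable s := by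
  refine ⟨?_, fun γ => Set.toFinite _⟩
  have := Fintype.ofFinite ι
  simpa using (Finset.isPWO_bUnion (s := Finset.univ)).2 fun i _ => (s i).isPWO_support

theorem support_seriesSum_subset (s : ι → HahnSeries Γ K) :
    (seriesSum s).support ⊆ ⋃ i, (s i).support := by
  by_cases h : IsSummable s
  · rw [← h.hsum_family]
    exact HahnSeries.SummableFamily.support_hsum_subset
  · rw [seriesSum, dif_neg h]; simp

theorem le_orderTop_seriesSum {s : ι → HahnSeries Γ K} {g : WithTop Γ}
    (h : ∀ i, g ≤ (s i).orderTop) : g ≤ (seriesSum s).orderTop := by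
  rw [HahnSeries.le_orderTop_iff_forall]
  intro j hj
  by_contra hne
  obtain ⟨i, hi⟩ := Set.mem_iUnion.1 (support_seriesSum_subset s hne)
  exact hi (HahnSeries.le_orderTop_iff_forall.1 (h i) j hj)

theorem lt_orderTop_seriesSum {s : ι → HahnSeries Γ K} {g : WithTop Γ} (hg : g ≠ ⊤)
    (h : ∀ i, g < (s i).orderTop) : g < (seriesSum s).orderTop := by
  by_contra hle
  rw [not_lt] at hle
  by_cases h0 : seriesSum s = 0
  · rw [h0, HahnSeries.orderTop_zero, top_le_iff] at hle
    exact hg hle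
  · rw [← HahnSeries.order_eq_orderTop_of_ne_zero h0] at hle
    have : (seriesSum s).order ∈ (seriesSum s).support := by
      simpa using HahnSeries.coeff_order_eq_zero.not.2 h0
    obtain ⟨i, hi⟩ := Set.mem_iUnion.1 (support_seriesSum_subset s this)
    exact absurd ((h i).trans_le ((HahnSeries.orderTop_le_of_coeff_ne_zero hi).trans hle))
      (lt_irrefl _)

/-! Iterated sums -/

theorem IsSummable.prod_right {s : ι × κ → HahnSeries Γ K} (h : IsSummable s) (i : ι) :
    IsSummable (fun k => s (i, k)) :=
  h.comp_injective (Prod.mk_right_injective i)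

theorem IsSummable.prod {s : ι × κ → HahnSeries Γ K} (h : IsSummable s) :
    IsSummable (fun i => seriesSum (fun k => s (i, k))) := by
  refine ⟨h.1.mono (Set.iUnion_subset fun i => (support_seriesSum_subset _).trans
    (Set.iUnion_subset fun k => Set.subset_iUnion (fun p => (s p).support) (i, k))), fun γ => ?_⟩
  refine ((h.2 γ).image Prod.fst).subset fun i hi => ?_
  obtain ⟨k, hk⟩ := Set.mem_iUnion.1 (support_seriesSum_subset _ hi)
  exact ⟨(i, k), hk, rfl⟩

theorem IsSummable.seriesSum_prod {s : ι × κ → HahnSeries Γ K} (h : IsSummable s) :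
    seriesSum s = seriesSum (fun i => seriesSum (fun k => s (i, k))) := by
  ext γ
  rw [h.coeff_seriesSum, h.prod.coeff_seriesSum, finsum_curry _ (h.2 γ)]
  exact finsum_congr fun i => ((h.prod_right i).coeff_seriesSum γ).symm

theorem IsSummable.seriesSum_comm {s : ι → κ → HahnSeries Γ K}
    (h : IsSummable fun p : ι × κ => s p.1 p.2) :
    seriesSum (fun i => seriesSum (fun k => s i k)) =
      seriesSum (fun k => seriesSum (fun i => s i k)) := by
  have h' : IsSummable fun p : κ × ι => s p.2 p.1 :=
    (isSummable_comp_equiv (s := fun p : ι × κ => s p.1 p.2) (Equiv.prodComm κ ι)).2 h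
  rw [← h.seriesSum_prod, ← h'.seriesSum_prod,
    ← seriesSum_comp_equiv (fun p : ι × κ => s p.1 p.2) (Equiv.prodComm κ ι)]
  rfl

/-! Powers -/

theorem isSummable_pow {x : HahnSeries Γ K} (hx : 0 < x.orderTop) :
    IsSummable (fun n : ℕ => x ^ n) := by
  have : (fun n : ℕ => x ^ n) = ⇑(HahnSeries.SummableFamily.powers x) := by
    rw [HahnSeries.SummableFamily.coe_powers hx]
  rw [this]; exact isSummable_coe _

theorem orderTop_pow (x : HahnSeries Γ K) (n : ℕ) : (x ^ n).orderTop = n • x.orderTop := by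
  induction n with
  | zero => simp
  | succ n ih => rw [pow_succ, HahnSeries.orderTop_mul, ih, succ_nsmul]

theorem mem_support_of_orderTop_eq {x : HahnSeries Γ K} {g : Γ} (h : x.orderTop = g) :
    g ∈ x.support :=
  HahnSeries.coeff_orderTop_ne h

theorem exists_orderTop_eq {x : HahnSeries Γ K} (hx : x ≠ 0) : ∃ g : Γ, x.orderTop = g :=
  ⟨x.order, (HahnSeries.order_eq_orderTop_of_ne_zero hx).symm⟩

theorem orderTop_pos_of_isSummable_pow {x : HahnSeries Γ K}
    (h : IsSummable (fun n : ℕ => x ^ n)) : 0 < x.orderTop := by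
  by_contra hle
  rw [not_lt] at hle
  have hx : x ≠ 0 := by rintro rfl; simp at hle
  obtain ⟨g, hg⟩ := exists_orderTop_eq hx
  rw [hg, ← WithTop.coe_zero, WithTop.coe_le_coe] at hle
  refine h.not_antitone (i := id) Function.injective_id (g := fun n => n • g)
    (antitone_nat_of_succ_le fun n => ?_) fun m => mem_support_of_orderTop_eq ?_
  · rw [succ_nsmul]; exact add_le_of_nonpos_right hle
  · rw [id, orderTop_pow, hg]; rfl

end Summable

/-! ### Strongly linear maps -/

section Strong

variable {Γ : Type u} [AddCommGroup Γ] [LinearOrder Γ] [IsOrderedAddMonoid Γ]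
  {Γ' : Type u'} [AddCommGroup Γ'] [LinearOrder Γ'] [IsOrderedAddMonoid Γ']
  {K : Type v} [Field K]

theorem mono_ne_zero (γ : Γ) : mono K γ ≠ 0 := by simp [mono]

theorem orderTop_mono (γ : Γ) : (mono K γ).orderTop = γ := by simp [mono]

theorem mono_add (a b : Γ) : mono K (a + b) = mono K a * mono K b := by simp [mono]

theorem mono_nsmul (n : ℕ) (a : Γ) : mono K (n • a) = mono K a ^ n := by simp [mono]

theorem mem_support_mono_mul {a g : Γ} {s : HahnSeries Γ K} :
    g ∈ (mono K a * s).support ↔ g - a ∈ s.support := by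
  have := HahnSeries.coeff_single_mul (r := (1 : K)) (x := s) (a := g) (b := a)
  simp only [HahnSeries.mem_support, mono, this, one_mul]

theorem isSummable_single {A : Set Γ} (hA : A.IsPWO) (c : A → K) :
    IsSummable (fun a : A => HahnSeries.single (a : Γ) (c a)) := by
  refine ⟨hA.mono (Set.iUnion_subset fun a => ?_), fun γ => ?_⟩
  · refine HahnSeries.support_single_subset.trans ?_
    simp
  · refine (Set.finite_singleton γ).preimage Subtype.coe_injective.injOn |>.subset fun a ha => ?_
    by_contra hne
    exact ha (HahnSeries.coeff_single_of_ne fun h => hne h.symm)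

theorem seriesSum_single (s : HahnSeries Γ K) :
    seriesSum (fun a : s.support => HahnSeries.single (a : Γ) (s.coeff a)) = s := by
  ext γ
  rw [(isSummable_single s.isPWO_support fun a => s.coeff a).coeff_seriesSum]
  by_cases hγ : γ ∈ s.support
  · rw [finsum_eq_single _ ⟨γ, hγ⟩ fun a ha =>
      HahnSeries.coeff_single_of_ne fun h => ha (Subtype.ext h.symm)]
    simp
  · rw [finsum_eq_zero_of_forall_eq_zero fun a : s.support =>
      HahnSeries.coeff_single_of_ne fun h : γ = a => hγ (h.symm ▸ a.2)]
    exact (not_not.1 hγ).symm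

variable {Φ : HahnSeries Γ K → HahnSeries Γ' K}

theorem IsStronglyLinear.map_single (hΦ : IsStronglyLinear Φ) (a : Γ) (c : K) :
    Φ (HahnSeries.single a c) = c • Φ (mono K a) := by
  rw [← hΦ.isLinear.map_smul, ← HahnSeries.single_zero_mul_eq_smul, mono,
    HahnSeries.single_mul_single, zero_add, mul_one]

theorem IsStronglyLinear.support_subset (hΦ : IsStronglyLinear Φ) (s : HahnSeries Γ K) :
    (Φ s).support ⊆ ⋃ a ∈ s.support, (Φ (mono K a)).support := by
  obtain ⟨-, h2⟩ := hΦ.map_sum s.support _ (isSummable_single s.isPWO_support fun a => s.coeff a)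
  rw [seriesSum_single] at h2
  rw [h2]
  refine (support_seriesSum_subset _).trans (Set.iUnion_subset fun a => ?_)
  refine Set.Subset.trans ?_ (Set.subset_biUnion_of_mem a.2)
  rw [hΦ.map_single]
  exact HahnSeries.support_smul_subset _ _

theorem IsStronglyLinear.isSummable_mono (hΦ : IsStronglyLinear Φ) {A : Set Γ} (hA : A.IsPWO) :
    IsSummable (fun a : A => Φ (mono K (a : Γ))) :=
  (hΦ.map_sum A _ (isSummable_single hA fun _ => 1)).1

theorem IsStronglyLinear.isPWO_support (hΦ : IsStronglyLinear Φ) {A : Set Γ} (hA : A.IsPWO) :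
    (⋃ a ∈ A, (Φ (mono K a)).support).IsPWO := by
  rw [Set.biUnion_eq_iUnion]
  exact (hΦ.isSummable_mono hA).1

theorem isPWO_range_of_monotone {f : ℕ → Γ} (hf : Monotone f) : (Set.range f).IsPWO := by
  rw [← Set.image_univ]
  exact (Set.isPWO_of_wellQuasiOrderedLE Set.univ).image_of_monotone hf

/-- Images of distinct monomials of a well-based sequence do not have a non-decreasing sequence
of monomials in their supports. -/
theorem IsStronglyLinear.not_antitone (hΦ : IsStronglyLinear Φ) {σ : ℕ → Γ} (hσ : StrictMono σ)
    {g : ℕ → Γ'} (hg : Antitone g) (hmem : ∀ m, g m ∈ (Φ (mono K (σ m))).support) : False :=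
  (hΦ.isSummable_mono (isPWO_range_of_monotone hσ.monotone)).not_antitone
    (i := fun m => ⟨σ m, m, rfl⟩) (fun _ _ h => hσ.injective (congrArg Subtype.val h)) hg hmem

theorem IsStronglyLinear.mul_right (hΦ : IsStronglyLinear Φ) (w : HahnSeries Γ' K) :
    IsStronglyLinear (fun s => Φ s * w) where
  isLinear := ⟨fun a b => by rw [hΦ.isLinear.map_add, add_mul],
    fun c a => by rw [hΦ.isLinear.map_smul, smul_mul_assoc]⟩
  map_sum ι s hs := by
    obtain ⟨h1, h2⟩ := hΦ.map_sum ι s hs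
    simp only [mul_comm _ w]
    exact ⟨h1.mul_left w, by rw [h2, h1.seriesSum_mul_left]⟩

/-- Strong linearity quantifies over index types in the universe of `Γ`; sequences are reached by
lifting `ℕ`. -/
theorem IsStronglyLinear.map_sum_nat (hΦ : IsStronglyLinear Φ) {s : ℕ → HahnSeries Γ K}
    (hs : IsSummable s) :
    IsSummable (fun n => Φ (s n)) ∧ Φ (seriesSum s) = seriesSum (fun n => Φ (s n)) := by
  obtain ⟨h1, h2⟩ := hΦ.map_sum (ULift.{u} ℕ) (fun n => s n.down)
    ((isSummable_comp_equiv Equiv.ulift).2 hs)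
  exact ⟨(isSummable_comp_equiv (s := fun n => Φ (s n)) Equiv.ulift).1 h1,
    ((congrArg Φ (seriesSum_comp_equiv s Equiv.ulift)).symm.trans h2).trans
      (seriesSum_comp_equiv (fun n => Φ (s n)) Equiv.ulift)⟩

end Strong

/-! ### Well-based iteration of a strongly linear derivation -/

section Iteration

variable {Γ : Type u} [AddCommGroup Γ] [LinearOrder Γ] [IsOrderedAddMonoid Γ]
  {K : Type v} [Field K]

/-- `Reaches D A β k γ` if there is a sequence of `k + 1` monomials starting in `A` and ending in
`γ`, each in the support of the derivative of the preceding one `p` and dominated by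
`p / β`. -/
inductive Reaches (D : Derivation K (HahnSeries Γ K) (HahnSeries Γ K)) (A : Set Γ) (β : Γ) :
    ℕ → Γ → Prop
  | start {a : Γ} : a ∈ A → Reaches D A β 0 a
  | step {k : ℕ} {p n : Γ} : Reaches D A β k p → n ∈ (D (mono K p)).support → p ≤ n + β →
      Reaches D A β (k + 1) n

variable {D : Derivation K (HahnSeries Γ K) (HahnSeries Γ K)}

theorem Reaches.mono {A : Set Γ} {β β' : Γ} (hβ : β ≤ β') {k : ℕ} {n : Γ}
    (h : Reaches D A β k n) : Reaches D A β' k n := by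
  induction h with
  | start ha => exact .start ha
  | step _ hn hp ih => exact ih.step hn (hp.trans (by gcongr))

/-- The Leibniz rule for 𝔭𝔟ᵏ, multiplied by 𝔟. It trades 𝔭' for the derivatives of 𝔭𝔟ᵏ and of 𝔟; in
the minimal bad sequence argument these two monomials, unlike 𝔭, range over well-based sets. -/
theorem mono_mul_derivation_mono_nsmul (b p : Γ) (k : ℕ) :
    TaylorDef.mono K ((k + 1) • b) * D (TaylorDef.mono K p) =
      TaylorDef.mono K b * D (TaylorDef.mono K (p + k • b)) -
        k • (TaylorDef.mono K (p + k • b) * D (TaylorDef.mono K b)) := by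
  rw [mono_add p, mono_nsmul, mono_nsmul, Derivation.leibniz, Derivation.leibniz_pow]
  rcases k with - | k
  · simp
  · simp only [smul_eq_mul, nsmul_eq_mul, Nat.add_sub_cancel]
    ring

theorem mem_of_mem_support_derivation_mono {b p n : Γ} {k : ℕ}
    (hn : n ∈ (D (TaylorDef.mono K p)).support) :
    (n + k • b ∈ (D (TaylorDef.mono K (p + k • b))).support) ∨
      n + (k + 1) • b - (p + k • b) ∈ (D (TaylorDef.mono K b)).support := by
  have h : n + (k + 1) • b ∈
      (TaylorDef.mono K ((k + 1) • b) * D (TaylorDef.mono K p)).support := by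
    rw [mem_support_mono_mul, add_sub_cancel_right]; exact hn
  rw [mono_mul_derivation_mono_nsmul] at h
  by_contra! hcon
  refine h ?_
  have h1 : n + (k + 1) • b ∉
      (TaylorDef.mono K b * D (TaylorDef.mono K (p + k • b))).support := by
    rw [mem_support_mono_mul, succ_nsmul, ← add_assoc, add_sub_cancel_right]; exact hcon.1
  have h2 : n + (k + 1) • b ∉
      (TaylorDef.mono K (p + k • b) * D (TaylorDef.mono K b)).support := by
    rw [mem_support_mono_mul]; exact hcon.2
  rw [HahnSeries.mem_support, not_not] at h1 h2
  rw [HahnSeries.coeff_sub, HahnSeries.coeff_nsmul, Pi.smul_apply, h1, h2]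
  simp

/-- Nash-Williams argument on the length of chains. In a minimal bad sequence almost all chains have
a last step; removing it gives triples `q` with no larger `z`. If `z ∘ q` strictly decreases along a
subsequence, splicing contradicts minimality. If it is monotone along one, the Leibniz identity
places the original values `z` in a sum of well-ordered sets, where they cannot strictly decrease.
-/
theorem Reaches.not_strictAnti (hD : IsStronglyLinear (fun s => D s)) {A : Set Γ} (hA : A.IsPWO)
    {β : ℕ → Γ} (hβ : Monotone β) {k : ℕ → ℕ} {n : ℕ → Γ}
    (hn : ∀ i, Reaches D A (β i) (k i) (n i)) : ¬ StrictAnti (fun i => n i + k i • β i) := by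
  let z : Γ × ℕ × Γ → Γ := fun e => e.2.2 + e.2.1 • e.1
  -- For this relation a bad sequence is exactly one with monotone `β` and strictly decreasing `z`.
  -- No transitivity is needed.
  let r : Γ × ℕ × Γ → Γ × ℕ × Γ → Prop := fun e e' => e.1 ≤ e'.1 → z e ≤ z e'
  let S : Set (Γ × ℕ × Γ) := {e | Reaches D A e.1 e.2.1 e.2.2}
  suffices H : S.PartiallyWellOrderedOn r by
    intro hanti
    refine (Set.PartiallyWellOrderedOn.iff_forall_not_isBadSeq r S).1 H
      (fun i => (β i, k i, n i)) ⟨hn, fun i j hij hr => ?_⟩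
    exact absurd (hr (hβ hij.le)) (not_le.2 (hanti hij))
  rw [Set.PartiallyWellOrderedOn.iff_not_exists_isMinBadSeq fun e => e.2.1]
  rintro ⟨f, ⟨hfS, hfr⟩, hmin⟩
  have hfβ : ∀ i j, i < j → (f i).1 ≤ (f j).1 := fun i j hij => (Classical.not_imp.1 (hfr i j hij)).1
  have hfz : ∀ i j, i < j → z (f j) < z (f i) := fun i j hij =>
    not_le.1 (Classical.not_imp.1 (hfr i j hij)).2
  -- Chains of length 0 end in the well-ordered set `A` and have `z` equal to their end point, so
  -- only finitely many can occur.
  obtain ⟨N, hN⟩ : ∃ N, ∀ i, N ≤ i → (f i).2.1 ≠ 0 := by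
    by_contra! hcon
    have hinf : {i | (f i).2.1 = 0}.Infinite := Set.infinite_of_not_bddAbove fun ⟨M, hM⟩ => by
      obtain ⟨i, hi, hi'⟩ := hcon (M + 1)
      exact absurd (hM hi') (by omega)
    obtain ⟨g, hg, hg'⟩ := exists_strictMono_of_infinite hinf
    refine not_strictAnti_of_isPWO hA (f := fun i => (f (g i)).2.2) (fun i => ?_) fun i j hij => ?_
    · have h1 : Reaches D A (f (g i)).1 (f (g i)).2.1 (f (g i)).2.2 := hfS (g i)
      rw [hg' i] at h1
      cases h1 with
      | start h => exact h
    · simpa [z, hg'] using hfz _ _ (hg hij)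
  have hpred : ∀ i, ∃ p, N ≤ i → ∃ l, (f i).2.1 = l + 1 ∧ Reaches D A (f i).1 l p ∧
      (f i).2.2 ∈ (D (TaylorDef.mono K p)).support ∧ p ≤ (f i).2.2 + (f i).1 := by
    intro i
    by_cases hi : N ≤ i
    · have h1 : Reaches D A (f i).1 (f i).2.1 (f i).2.2 := hfS i
      generalize hk : (f i).2.1 = kk at h1
      generalize (f i).2.2 = nn at h1
      cases h1 with
      | start h => exact absurd hk (hN i hi)
      | step hr hn hp => exact ⟨_, fun _ => ⟨_, rfl, hr, hn, hp⟩⟩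
    · exact ⟨0, fun h => absurd h hi⟩
  choose p hp using hpred
  let q : ℕ → Γ × ℕ × Γ := fun i => ((f i).1, (f i).2.1 - 1, p i)
  have hqS : ∀ i, N ≤ i → q i ∈ S := fun i hi => by
    obtain ⟨l, hl, hr, -, -⟩ := hp i hi
    simpa [q, S, hl] using hr
  have hqz : ∀ i, N ≤ i → z (q i) ≤ z (f i) := fun i hi => by
    obtain ⟨l, hl, -, -, hle⟩ := hp i hi
    simp only [q, z, hl, Nat.add_sub_cancel, succ_nsmul]
    calc p i + l • (f i).1 ≤ ((f i).2.2 + (f i).1) + l • (f i).1 := by gcongr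
      _ = _ := by abel
  obtain ⟨φ, hφ, hm | ha⟩ := exists_monotone_or_strictAnti (fun i => z (q (N + i)))
  · have hb : Monotone fun i => (f (N + φ i)).1 := monotone_nat_of_le_succ fun i =>
      hfβ _ _ (by have := hφ (Nat.lt_add_one i); omega)
    -- The two summands match the two alternatives of `mem_of_mem_support_derivation_mono`: `z (f
    -- i)` is `β` plus a value from the derivative of the monomial `z (q i)`, or `z (q i)` plus a
    -- value from the derivative of the monomial `β`.
    have hP := ((isPWO_range_of_monotone hb).add
      (hD.isPWO_support (isPWO_range_of_monotone hm))).union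
      ((isPWO_range_of_monotone hm).add (hD.isPWO_support (isPWO_range_of_monotone hb)))
    refine not_strictAnti_of_isPWO hP (f := fun i => z (f (N + φ i))) (fun i => ?_)
      fun i j hij => hfz _ _ (by have := hφ hij; omega)
    obtain ⟨l, hl, -, hsupp, -⟩ := hp (N + φ i) (Nat.le_add_right _ _)
    have hqi : z (q (N + φ i)) = p (N + φ i) + l • (f (N + φ i)).1 := by simp [z, q, hl]
    have hzi : z (f (N + φ i)) = (f (N + φ i)).2.2 + (l + 1) • (f (N + φ i)).1 := by simp [z, hl]
    rcases mem_of_mem_support_derivation_mono (b := (f (N + φ i)).1) (k := l) hsupp with h | h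
    · refine Or.inl (Set.mem_add.2 ⟨_, ⟨i, rfl⟩, _,
        Set.mem_biUnion (x := z (q (N + φ i))) ⟨i, rfl⟩ (hqi ▸ h), ?_⟩)
      rw [hzi, succ_nsmul]; abel
    · refine Or.inr (Set.mem_add.2 ⟨z (q (N + φ i)), ⟨i, rfl⟩, _,
        Set.mem_biUnion (x := (f (N + φ i)).1) ⟨i, rfl⟩ h, ?_⟩)
      rw [hzi, hqi]; abel
  · have hle : ∀ m, N + φ 0 ≤ N + φ m := fun m => by have := hφ.monotone (Nat.zero_le m); omega
    -- The spliced sequence keeps `f` below `N + φ 0` and continues with the shortened chains, hence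
    -- is shorter at that index. It is still bad because `z (q i) ≤ z (f i)`.
    refine hmin (N + φ 0)
      (fun m => if m < N + φ 0 then f m else q (N + φ (m - (N + φ 0))))
      (fun m hm => by simp [hm]) ?_ ⟨fun m => ?_, fun m m' hmm' hr => ?_⟩
    · obtain ⟨l, hl, -⟩ := hp (N + φ 0) (Nat.le_add_right _ _)
      simp [q, hl]
    · dsimp only
      split_ifs
      · exact hfS m
      · exact hqS _ (Nat.le_add_right _ _)
    · dsimp only at hr
      by_cases h2 : m' < N + φ 0
      · rw [if_pos h2, if_pos (hmm'.trans h2)] at hr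
        exact hfr m m' hmm' hr
      · rw [if_neg h2] at hr
        by_cases h1 : m < N + φ 0
        · rw [if_pos h1] at hr
          have hlt : m < N + φ (m' - (N + φ 0)) := h1.trans_le (hle _)
          exact absurd (hr (hfβ _ _ hlt))
            (not_le.2 ((hqz _ (Nat.le_add_right _ _)).trans_lt (hfz _ _ hlt)))
        · rw [if_neg h1] at hr
          have hlt : m - (N + φ 0) < m' - (N + φ 0) := by omega
          exact absurd (hr (hfβ _ _ (by have := hφ hlt; omega))) (not_le.2 (ha hlt))

theorem Reaches.exists_monotone (hD : IsStronglyLinear (fun s => D s)) {A : Set Γ}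
    (hA : A.IsPWO) {β : ℕ → Γ} (hβ : Monotone β) {k : ℕ → ℕ} {n : ℕ → Γ}
    (hn : ∀ i, Reaches D A (β i) (k i) (n i)) :
    ∃ φ : ℕ → ℕ, StrictMono φ ∧ Monotone (fun i => n (φ i) + k (φ i) • β (φ i)) := by
  obtain ⟨φ, hφ, h | h⟩ := exists_monotone_or_strictAnti (fun i => n i + k i • β i)
  · exact ⟨φ, hφ, h⟩
  · exact absurd h (Reaches.not_strictAnti hD hA (hβ.comp hφ.monotone)
      (k := k ∘ φ) (n := n ∘ φ) fun i => hn (φ i))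

end Iteration

/-! ### Monomials with the same asymptotic size of logarithmic derivative -/

section LogDerOrder

variable {Γ : Type u} [AddCommGroup Γ] [LinearOrder Γ] [IsOrderedAddMonoid Γ]
  {K : Type v} [Field K] {D : Derivation K (HahnSeries Γ K) (HahnSeries Γ K)}

theorem derivation_mono (D : Derivation K (HahnSeries Γ K) (HahnSeries Γ K)) (γ : Γ) :
    D (mono K γ) = mono K γ * logDer D γ := by
  rw [logDer, mul_div_cancel₀ _ (mono_ne_zero γ)]

theorem orderTop_derivation_mono (γ : Γ) :
    (D (mono K γ)).orderTop = γ + (logDer D γ).orderTop := by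
  rw [derivation_mono, HahnSeries.orderTop_mul, orderTop_mono]

/-- The group of monomials `γ` with `γ† ≺ β⁻¹`. -/
def smallLogDer (D : Derivation K (HahnSeries Γ K) (HahnSeries Γ K)) (β : Γ) :
    AddSubgroup Γ where
  carrier := {γ | ((-β : Γ) : WithTop Γ) < (logDer D γ).orderTop}
  zero_mem' := by
    rw [Set.mem_ofPred_eq, logDer_zero, HahnSeries.orderTop_zero]
    exact WithTop.coe_lt_top _
  add_mem' {a b} ha hb := by
    simp only [Set.mem_ofPred_eq, logDer_add] at *
    exact (lt_min ha hb).trans_le HahnSeries.min_orderTop_le_orderTop_add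
  neg_mem' {a} ha := by
    simp only [Set.mem_ofPred_eq, logDer_neg, HahnSeries.orderTop_neg] at *
    exact ha

theorem mem_smallLogDer {β γ : Γ} :
    γ ∈ smallLogDer D β ↔ ((-β : Γ) : WithTop Γ) < (logDer D γ).orderTop := Iff.rfl

theorem mem_smallLogDer_of_orderTop_eq {β β' γ : Γ} (h : β < β')
    (hγ : (logDer D γ).orderTop = ((-β : Γ) : WithTop Γ)) : γ ∈ smallLogDer D β' := by
  rw [mem_smallLogDer, hγ, WithTop.coe_lt_coe]
  exact neg_lt_neg h

theorem smallLogDer_mono {β β' : Γ} (h : β ≤ β') : smallLogDer D β ≤ smallLogDer D β' :=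
  fun _ hγ => lt_of_le_of_lt (WithTop.coe_le_coe.2 (neg_le_neg h)) hγ

theorem orderTop_logDer_of_sub_mem {β a b : Γ} (hab : a - b ∈ smallLogDer D β)
    (hb : (logDer D b).orderTop = ((-β : Γ) : WithTop Γ)) :
    (logDer D a).orderTop = ((-β : Γ) : WithTop Γ) := by
  have : logDer D a = logDer D b + logDer D (a - b) := by rw [← logDer_add, add_sub_cancel]
  rw [this, HahnSeries.orderTop_add_eq_left (hb ▸ hab), hb]

/-- Division with remainder, normalised to remainders in (0, C] by taking the least `N` with `d ≤ N
• C`. The bound `hM` replaces the Archimedean property. -/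
theorem exists_nsmul_sub_mem_Ioc {d C : Γ} (hd : 0 ≤ d) (hC : 0 < C) {M : ℕ} (hM : d ≤ M • C) :
    ∃ N : ℕ, 0 < d + C - N • C ∧ d + C - N • C ≤ C := by
  classical
  have hex : ∃ N : ℕ, d ≤ N • C := ⟨M, hM⟩
  refine ⟨Nat.find hex, ?_, ?_⟩
  · rcases hN : Nat.find hex with - | N
    · rw [zero_nsmul, sub_zero]; exact add_pos_of_nonneg_of_pos hd hC
    · have := Nat.find_min hex (m := N) (by omega)
      rw [succ_nsmul, add_sub_add_right_eq_sub, sub_pos]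
      exact not_le.1 this
  · have := Nat.find_spec hex
    rw [sub_le_iff_le_add, add_comm C]
    gcongr

/-- If no `i` works, every `i` has later indices `o < e'` whose values `n + k • β i` decrease
although the `z` increase. Reducing the gap `z e' - z o` modulo `β e' - β i` gives a small positive
`r` whose logarithmic derivative has value exactly `-β e'`. Partial sums `σ` of such `r` strictly
increase, while the leading values `σ - β` of their derivatives do not increase; this contradicts
strong linearity of the derivation. -/
theorem exists_monotone_of_strictMono (hD : IsStronglyLinear (fun s => D s)) {β n : ℕ → Γ}
    {k : ℕ → ℕ} (hβ : StrictMono β)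
    (hz : Monotone (fun i => n i + k i • β i))
    (hn : ∀ i, (logDer D (n i)).orderTop = ((-(β i) : Γ) : WithTop Γ))
    (hb : ∀ i, β i ∈ smallLogDer D (β i)) :
    ∃ i, ∀ j l, i < j → j < l → n j + k j • β i ≤ n l + k l • β i := by
  by_contra! h
  choose o e' ho he' hlt using h
  let z : ℕ → Γ := fun i => n i + k i • β i
  have hzlog : ∀ i, (logDer D (z i)).orderTop = ((-(β i) : Γ) : WithTop Γ) := fun i =>
    orderTop_logDer_of_sub_mem (b := n i)
      (by simpa [z] using (smallLogDer D (β i)).nsmul_mem (hb i) (k i)) (hn i)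
  have hr : ∀ i, ∃ r : Γ, 0 < r ∧ r ≤ β (e' i) - β i ∧
      r - z (e' i) ∈ smallLogDer D (β (e' i)) := by
    intro i
    have hlo : β i < β (e' i) := hβ ((ho i).trans (he' i))
    have hd0 : 0 ≤ z (e' i) - z (o i) := sub_nonneg.2 (hz (he' i).le)
    have hd1 : z (e' i) - z (o i) ≤ k (e' i) • (β (e' i) - β i) := by
      have h1 : k (o i) • β i ≤ k (o i) • β (o i) := nsmul_le_nsmul_right (hβ (ho i)).le _
      simp only [z, nsmul_sub]
      have h2 := (hlt i).le
      rw [sub_le_iff_le_add]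
      calc n (e' i) + k (e' i) • β (e' i)
          = (n (e' i) + k (e' i) • β i) + (k (e' i) • β (e' i) - k (e' i) • β i) := by abel
        _ ≤ (n (o i) + k (o i) • β (o i)) + (k (e' i) • β (e' i) - k (e' i) • β i) := by
            exact add_le_add (h2.trans (add_le_add le_rfl h1)) le_rfl
        _ = _ := by abel
    obtain ⟨N, hN0, hN1⟩ := exists_nsmul_sub_mem_Ioc hd0 (sub_pos.2 hlo) hd1
    refine ⟨_, hN0, hN1, ?_⟩
    -- Modulo monomials with logarithmic derivative of value greater than `-β (e' i)`, the remainder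
    -- `r` is `z (e' i)`.
    have m1 : z (o i) ∈ smallLogDer D (β (e' i)) :=
      mem_smallLogDer_of_orderTop_eq (hβ (he' i)) (hzlog _)
    have m2 : β (e' i) - β i ∈ smallLogDer D (β (e' i)) :=
      sub_mem (hb _) (smallLogDer_mono hlo.le (hb i))
    have : z (e' i) - z (o i) + (β (e' i) - β i) - N • (β (e' i) - β i) - z (e' i) =
        -z (o i) + (β (e' i) - β i) - N • (β (e' i) - β i) := by abel
    rw [this]
    exact sub_mem (add_mem (neg_mem m1) m2) (AddSubgroup.nsmul_mem _ m2 N)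
  choose r hr0 hr1 hr2 using hr
  -- Iterating `i ↦ e' i` makes the bounds `r ≤ β (e (m + 1)) - β (e m)` telescope, so that adding
  -- `r` to `σ` never outruns the growth of `β`.
  let e : ℕ → ℕ := fun m => Nat.rec 0 (fun _ i => e' i) m
  have he : ∀ m, e (m + 1) = e' (e m) := fun m => rfl
  let σ : ℕ → Γ := fun m => Nat.rec (z 0) (fun i s => s + r (e i)) m
  have hσ : ∀ m, σ (m + 1) = σ m + r (e m) := fun m => rfl
  have hσlog : ∀ m, (logDer D (σ m)).orderTop = ((-(β (e m)) : Γ) : WithTop Γ) := by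
    intro m
    induction m with
    | zero => exact hzlog 0
    | succ m ih =>
      refine orderTop_logDer_of_sub_mem (b := z (e (m + 1))) ?_ (hzlog _)
      rw [hσ, add_sub_assoc]
      exact add_mem (mem_smallLogDer_of_orderTop_eq (hβ ((ho _).trans (he' _))) ih) (hr2 _)
  refine hD.not_antitone (σ := σ) (strictMono_nat_of_lt_succ fun m => ?_)
    (g := fun m => σ m - β (e m)) (antitone_nat_of_succ_le fun m => ?_) fun m => ?_
  · rw [hσ]; exact lt_add_of_pos_right _ (hr0 _)
  · have h1 := hr1 (e m)
    rw [← he] at h1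
    rw [hσ, sub_le_sub_iff, add_assoc]
    gcongr
    exact le_sub_iff_add_le.1 h1
  · refine mem_support_of_orderTop_eq ?_
    rw [orderTop_derivation_mono, hσlog, ← WithTop.coe_add, sub_eq_add_neg]

end LogDerOrder

/-! ### Dominance and strongly linear morphisms -/

section Morphism

variable {Γ : Type u} [AddCommGroup Γ] [LinearOrder Γ] [IsOrderedAddMonoid Γ]
  {Γ' : Type u'} [AddCommGroup Γ'] [LinearOrder Γ'] [IsOrderedAddMonoid Γ']
  {K : Type v} [Field K] {Δ : HahnSeries Γ K →ₐ[K] HahnSeries Γ' K}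

theorem lt_orderTop_of_forall {x : HahnSeries Γ K} {g : Γ} (h : ∀ j ≤ g, x.coeff j = 0) :
    (g : WithTop Γ) < x.orderTop := by
  by_contra hle
  rw [not_lt] at hle
  have hx : x ≠ 0 := by rintro rfl; simp at hle
  obtain ⟨j, hj⟩ := exists_orderTop_eq hx
  rw [hj, WithTop.coe_le_coe] at hle
  exact mem_support_of_orderTop_eq hj (h j hle)

/-- Being infinitesimal is equivalent to summability of the powers, a property preserved by strongly
linear ring morphisms. -/
theorem orderTop_map_pos (hΔ : IsStronglyLinear (fun s => Δ s)) {u : HahnSeries Γ K}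
    (hu : 0 < u.orderTop) : 0 < (Δ u).orderTop := by
  refine orderTop_pos_of_isSummable_pow ?_
  simpa only [map_pow] using (hΔ.map_sum_nat (isSummable_pow hu)).1

theorem orderTop_C_nonneg (c : K) : 0 ≤ (HahnSeries.C c : HahnSeries Γ K).orderTop := by
  rw [HahnSeries.C_apply]
  exact HahnSeries.orderTop_single_le

theorem orderTop_sub_C_pos {u : HahnSeries Γ K} (hu : 0 ≤ u.orderTop) :
    0 < (u - HahnSeries.C (u.coeff 0)).orderTop := by
  refine lt_orderTop_of_forall fun j hj => ?_
  rcases hj.eq_or_lt with rfl | hj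
  · simp
  · rw [HahnSeries.coeff_sub, HahnSeries.coeff_eq_zero_of_lt_orderTop
      ((WithTop.coe_lt_coe.2 hj).trans_le hu), HahnSeries.C_apply,
      HahnSeries.coeff_single_of_ne hj.ne, sub_zero]

theorem algebraMap_hahn (c : K) : algebraMap K (HahnSeries Γ K) c = HahnSeries.C c := by
  rw [HahnSeries.algebraMap_apply]; rfl

theorem map_C (c : K) : Δ (HahnSeries.C c) = HahnSeries.C c := by
  rw [← algebraMap_hahn, ← algebraMap_hahn, AlgHom.commutes]

theorem orderTop_map_nonneg (hΔ : IsStronglyLinear (fun s => Δ s)) {u : HahnSeries Γ K}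
    (hu : 0 ≤ u.orderTop) : 0 ≤ (Δ u).orderTop := by
  have h : Δ u = HahnSeries.C (u.coeff 0) + Δ (u - HahnSeries.C (u.coeff 0)) := by
    rw [map_sub, map_C, add_sub_cancel]
  rw [h]
  exact (le_min (orderTop_C_nonneg _) (orderTop_map_pos hΔ (orderTop_sub_C_pos hu)).le).trans
    HahnSeries.min_orderTop_le_orderTop_add

theorem orderTop_div_nonneg {s t : HahnSeries Γ K} (hs : s ≠ 0) (h : s.orderTop ≤ t.orderTop) :
    0 ≤ (t / s).orderTop := by
  by_contra hlt
  rw [not_le] at hlt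
  have h1 : t.orderTop = s.orderTop + (t / s).orderTop := by
    rw [← HahnSeries.orderTop_mul, mul_div_cancel₀ _ hs]
  obtain ⟨a, ha⟩ := exists_orderTop_eq hs
  obtain ⟨b, hb⟩ : ∃ b : Γ, (t / s).orderTop = b :=
    exists_orderTop_eq (by rintro h0; simp [h0] at hlt)
  rw [h1, ha, hb, ← WithTop.coe_add, WithTop.coe_le_coe] at h
  rw [hb, ← WithTop.coe_zero, WithTop.coe_lt_coe] at hlt
  exact absurd h (by simpa using hlt)

theorem orderTop_map_le (hΔ : IsStronglyLinear (fun s => Δ s)) {s t : HahnSeries Γ K}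
    (h : s.orderTop ≤ t.orderTop) : (Δ s).orderTop ≤ (Δ t).orderTop := by
  by_cases hs : s = 0
  · rw [hs, HahnSeries.orderTop_zero, top_le_iff, HahnSeries.orderTop_eq_top] at h
    simp [hs, h]
  · have h1 : (Δ t).orderTop = (Δ s).orderTop + (Δ (t / s)).orderTop := by
      rw [← HahnSeries.orderTop_mul, ← map_mul, mul_div_cancel₀ _ hs]
    rw [h1]
    exact le_add_of_nonneg_right (orderTop_map_nonneg hΔ (orderTop_div_nonneg hs h))

/-- Each Δ(𝔫)δᵏ is Δ(𝔫𝔟ᵏ)(Δ(𝔟⁻¹)δ)ᵏ, a member of the product of two summable families: images of a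
well-based set of monomials, and powers of an infinitesimal. -/
theorem not_antitone_of_monotone_add_nsmul (hΔ : IsStronglyLinear (fun s => Δ s))
    {δ : HahnSeries Γ' K} {β : Γ} (hβ : 0 < (Δ (mono K (-β)) * δ).orderTop) {n : ℕ → Γ}
    {k : ℕ → ℕ} (hk : StrictMono k) (hn : Monotone (fun i => n i + k i • β)) {g : ℕ → Γ'}
    (hg : Antitone g) (hmem : ∀ i, g i ∈ (Δ (mono K (n i)) * δ ^ k i).support) : False := by
  have hs := (hΔ.isSummable_mono (isPWO_range_of_monotone hn)).mul (isSummable_pow hβ)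
  refine hs.not_antitone (i := fun i => (⟨_, i, rfl⟩, k i))
    (fun i j h => hk.injective (congrArg Prod.snd h)) hg fun i => ?_
  convert hmem i using 2
  simp only
  rw [mul_pow, ← mul_assoc, ← map_pow, ← map_mul, ← mono_nsmul, ← mono_add, smul_neg,
    add_neg_cancel_right]

end Morphism

/-! ### Summability of Taylor expansions -/

section TaylorSummable

variable {Γ : Type u} [AddCommGroup Γ] [LinearOrder Γ] [IsOrderedAddMonoid Γ]
  {Γ' : Type u'} [AddCommGroup Γ'] [LinearOrder Γ'] [IsOrderedAddMonoid Γ']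
  {K : Type v} [Field K]
  {D : Derivation K (HahnSeries Γ K) (HahnSeries Γ K)} {x : HahnSeries Γ K}

open scoped Classical in
/-- The value of the smallest monomial `𝔟 ≼ x` such that `𝔪† ≼ 𝔟⁻¹`, where `𝔪` is the monomial
given by `γ`. -/
def growth (D : Derivation K (HahnSeries Γ K) (HahnSeries Γ K)) (x : HahnSeries Γ K) (γ : Γ) : Γ :=
  if Dominated (logDer D γ) x⁻¹ then x.order else -(logDer D γ).order

theorem orderTop_inv (hx : x ≠ 0) : (x⁻¹).orderTop = ((-x.order : Γ) : WithTop Γ) := by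
  have h : x.orderTop + (x⁻¹).orderTop = 0 := by
    rw [← HahnSeries.orderTop_mul, mul_inv_cancel₀ hx, HahnSeries.orderTop_one]
  obtain ⟨b, hb⟩ := exists_orderTop_eq (inv_ne_zero hx)
  rw [← HahnSeries.order_eq_orderTop_of_ne_zero hx, hb, ← WithTop.coe_add, ← WithTop.coe_zero,
    WithTop.coe_inj] at h
  rw [hb, WithTop.coe_inj]
  exact (neg_eq_of_add_eq_zero_right h).symm

theorem orderTop_logDer_of_not_dominated {γ : Γ} (h : ¬ Dominated (logDer D γ) x⁻¹) :
    (logDer D γ).orderTop = ((-growth D x γ : Γ) : WithTop Γ) := by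
  rw [growth, if_neg h, neg_neg]
  refine (HahnSeries.order_eq_orderTop_of_ne_zero ?_).symm
  rintro h0
  exact h (by rw [h0, Dominated, HahnSeries.orderTop_zero]; exact le_top)

theorem neg_growth_le_orderTop_logDer (hx : x ≠ 0) (γ : Γ) :
    ((-growth D x γ : Γ) : WithTop Γ) ≤ (logDer D γ).orderTop := by
  by_cases h : Dominated (logDer D γ) x⁻¹
  · rw [growth, if_pos h, ← orderTop_inv hx]
    exact h
  · exact (orderTop_logDer_of_not_dominated h).ge

theorem order_le_growth (hx : x ≠ 0) (γ : Γ) : x.order ≤ growth D x γ := by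
  by_cases h : Dominated (logDer D γ) x⁻¹
  · rw [growth, if_pos h]
  · have h' := h
    rw [Dominated, not_le, orderTop_logDer_of_not_dominated h', orderTop_inv hx,
      WithTop.coe_lt_coe, neg_lt_neg_iff] at h
    exact h.le

theorem orderTop_logDer_of_order_lt_growth {γ : Γ} (h : x.order < growth D x γ) :
    (logDer D γ).orderTop = ((-growth D x γ : Γ) : WithTop Γ) := by
  refine orderTop_logDer_of_not_dominated fun h' => ?_
  rw [growth, if_pos h'] at h
  exact lt_irrefl _ h

/-- This is the form in which the special condition is used: 𝔟 is an invariant of chains of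
derivatives. -/
theorem growth_eq_of_mem_support (hspec : SpecialCondition D x) {γ n : Γ}
    (hn : n ∈ (D (mono K γ)).support) : growth D x n = growth D x γ := by
  rcases hspec γ with ⟨h1, h2⟩ | ⟨h1, h2⟩
  · rw [growth, growth, if_pos h1, if_pos (h2 n hn)]
  · have hγ : ¬ Dominated (logDer D γ) x⁻¹ := not_le.2 h1
    have he : (logDer D n).orderTop = (logDer D γ).orderTop := le_antisymm (h2 n hn).2 (h2 n hn).1
    have hn' : ¬ Dominated (logDer D n) x⁻¹ := by rw [Dominated, he]; exact hγ
    have := (orderTop_logDer_of_not_dominated hn').symm.trans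
      (he.trans (orderTop_logDer_of_not_dominated hγ))
    simpa using this

theorem le_add_growth (hx : x ≠ 0) {γ n : Γ} (hn : n ∈ (D (mono K γ)).support) :
    γ ≤ n + growth D x γ := by
  have h1 := HahnSeries.orderTop_le_of_coeff_ne_zero hn
  rw [orderTop_derivation_mono] at h1
  have h2 := (add_le_add_right (neg_growth_le_orderTop_logDer (D := D) hx γ) (γ : WithTop Γ)).trans
    h1
  rw [← WithTop.coe_add, WithTop.coe_le_coe, ← sub_eq_add_neg] at h2
  exact sub_le_iff_le_add.1 h2

/-- Let 𝔪† ≍ 𝔟⁻¹. Then 𝔪/𝔟 is the leading monomial of 𝔪', so it has the same 𝔟 and (𝔪/𝔟)† ≼ 𝔟⁻¹.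
Hence 𝔟† = 𝔪† − (𝔪/𝔟)† ≼ 𝔟⁻¹, that is 𝔟' ≼ 1; if 𝔟† is not ≺ 𝔟⁻¹, then 𝔟' ≍ 1. Strong linearity
allows this for only finitely many 𝔟 of a well-based sequence. -/
theorem orderTop_derivation_mono_growth (hx : x ≠ 0) (hspec : SpecialCondition D x) {γ : Γ}
    (hγ : x.order < growth D x γ) (h : growth D x γ ∉ smallLogDer D (growth D x γ)) :
    (D (mono K (growth D x γ))).orderTop = (0 : Γ) := by
  have h1 := orderTop_logDer_of_order_lt_growth hγ
  have h2 : γ - growth D x γ ∈ (D (mono K γ)).support := mem_support_of_orderTop_eq (by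
    rw [orderTop_derivation_mono, h1, ← WithTop.coe_add, sub_eq_add_neg])
  have h3 := neg_growth_le_orderTop_logDer (D := D) hx (γ - growth D x γ)
  rw [growth_eq_of_mem_support hspec h2] at h3
  have h4 : logDer D (growth D x γ) = logDer D γ - logDer D (γ - growth D x γ) := by
    rw [eq_sub_iff_add_eq, ← logDer_add, add_sub_cancel]
  have h5 : ((-growth D x γ : Γ) : WithTop Γ) ≤ (logDer D (growth D x γ)).orderTop := by
    rw [h4]
    exact (le_min h1.ge h3).trans HahnSeries.min_orderTop_le_orderTop_sub
  rw [orderTop_derivation_mono, le_antisymm (not_lt.1 h) h5, ← WithTop.coe_add, add_neg_cancel]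

theorem reaches_of_mem_support_iterate (hD : IsStronglyLinear (fun s => D s)) (hx : x ≠ 0)
    (hspec : SpecialCondition D x) (s : HahnSeries Γ K) (k : ℕ) {n : Γ}
    (hn : n ∈ ((fun t => D t)^[k] s).support) :
    Reaches D s.support (growth D x n) k n ∧ ∃ a ∈ s.support, growth D x n = growth D x a := by
  induction k generalizing n with
  | zero => exact ⟨.start hn, n, hn, rfl⟩
  | succ k ih =>
    rw [Function.iterate_succ_apply'] at hn
    obtain ⟨p, hp, hnp⟩ := Set.mem_iUnion₂.1 (hD.support_subset _ hn)
    obtain ⟨h1, a, ha, h2⟩ := ih hp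
    have h3 := growth_eq_of_mem_support hspec hnp
    rw [h3]
    exact ⟨h1.step hnp (le_add_growth hx hnp), a, ha, h2⟩

variable {Δ : HahnSeries Γ K →ₐ[K] HahnSeries Γ' K} {δ : HahnSeries Γ' K}

/-- The two cases of `growth` use the two hypotheses on δ: δ ≺ Δ(x) when 𝔟 ≍ x, and Δ(𝔪†)δ ≺ 1 when
𝔟⁻¹ ≍ 𝔪†. -/
theorem orderTop_map_mono_neg_growth_pos (hΔ : IsStronglyLinear (fun s => Δ s)) (hx : x ≠ 0)
    (hδ : StrictlyDominated δ (Δ x)) {γ : Γ} (hγ : γ ∈ taylorGroup D Δ δ) :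
    0 < (Δ (mono K (-growth D x γ)) * δ).orderTop := by
  by_cases h : Dominated (logDer D γ) x⁻¹
  · have h1 : (Δ x⁻¹).orderTop ≤ (Δ (mono K (-growth D x γ))).orderTop :=
      orderTop_map_le hΔ (by rw [orderTop_mono, growth, if_pos h, orderTop_inv hx])
    have hΔx : Δ x ≠ 0 := (map_ne_zero Δ).2 hx
    have h2 : (0 : WithTop Γ') = (Δ x⁻¹).orderTop + (Δ x).orderTop := by
      rw [← HahnSeries.orderTop_mul, ← map_mul, inv_mul_cancel₀ hx, map_one,
        HahnSeries.orderTop_one]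
    rw [HahnSeries.orderTop_mul]
    refine lt_of_lt_of_le ?_ (add_le_add_left h1 _)
    rw [h2]
    exact WithTop.add_lt_add_left
      (HahnSeries.orderTop_ne_top.2 ((map_ne_zero Δ).2 (inv_ne_zero hx))) hδ
  · have h1 : (Δ (logDer D γ)).orderTop ≤ (Δ (mono K (-growth D x γ))).orderTop :=
      orderTop_map_le hΔ (by rw [orderTop_mono, orderTop_logDer_of_not_dominated h])
    have h2 : (1 : HahnSeries Γ' K).orderTop < (Δ (logDer D γ) * δ).orderTop := hγ
    rw [HahnSeries.orderTop_one, HahnSeries.orderTop_mul] at h2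
    rw [HahnSeries.orderTop_mul]
    exact h2.trans_le (add_le_add_left h1 _)

theorem support_taylorTerm_subset (s : HahnSeries Γ K) (k : ℕ) :
    (taylorTerm D Δ δ s k).support ⊆ (Δ ((fun t => D t)^[k] s) * δ ^ k).support :=
  HahnSeries.support_smul_subset _ _

theorem exists_mem_support_of_mem_support_taylorTerm (hΔ : IsStronglyLinear (fun s => Δ s))
    {s : HahnSeries Γ K} {k : ℕ} {g : Γ'} (hg : g ∈ (taylorTerm D Δ δ s k).support) :
    ∃ n ∈ ((fun t => D t)^[k] s).support, g ∈ (Δ (mono K n) * δ ^ k).support := by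
  obtain ⟨n, hn, h⟩ := Set.mem_iUnion₂.1
    ((hΔ.mul_right (δ ^ k)).support_subset _ (support_taylorTerm_subset s k hg))
  exact ⟨n, hn, h⟩

theorem isSummable_taylorTerm (hD : IsStronglyLinear (fun s => D s))
    (hΔ : IsStronglyLinear (fun s => Δ s)) (hx : x ≠ 0) (hspec : SpecialCondition D x)
    (hδ : StrictlyDominated δ (Δ x)) {s : HahnSeries Γ K}
    (hs : s.support ⊆ taylorGroup D Δ δ) : IsSummable (taylorTerm D Δ δ s) := by
  refine isSummable_of_not_antitone fun k g hk hg hmem => ?_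
  choose n hn hgn using fun i => exists_mem_support_of_mem_support_taylorTerm hΔ (hmem i)
  have hreach := fun i => (reaches_of_mem_support_iterate hD hx hspec s (k i) (hn i)).1
  have hε : ∀ i, 0 < (Δ (mono K (-growth D x (n i))) * δ).orderTop := fun i => by
    obtain ⟨-, a, ha, h⟩ := reaches_of_mem_support_iterate hD hx hspec s (k i) (hn i)
    rw [h]
    exact orderTop_map_mono_neg_growth_pos hΔ hx hδ (hs ha)
  -- It remains to replace the varying 𝔟 by a single one for which the values of 𝔫𝔟ᵏ are monotone
  -- along a subsequence.
  obtain ⟨φ, hφ, hm | ha⟩ := exists_strictMono_or_antitone (fun i => growth D x (n i))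
  · obtain ⟨ψ, hψ, hz⟩ := Reaches.exists_monotone hD s.isPWO_support hm.monotone
      (fun i => hreach (φ i))
    -- Exceptions are monomials 𝔟 with 𝔟' ≍ 1. Infinitely many of them, strictly increasing in
    -- value, would put the value 0 in infinitely many supports.
    have hfin : {i | growth D x (n (φ (ψ i))) ∉
        smallLogDer D (growth D x (n (φ (ψ i))))}.Finite := by
      by_contra hinf
      obtain ⟨χ, hχ, hχ'⟩ := exists_strictMono_of_infinite hinf
      have hlt : ∀ i, growth D x (n (φ (ψ (χ 0)))) < growth D x (n (φ (ψ (χ (i + 1))))) :=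
        fun i => hm (hψ (hχ (Nat.succ_pos i)))
      refine hD.not_antitone (σ := fun i => growth D x (n (φ (ψ (χ (i + 1))))))
        (hm.comp (hψ.comp (hχ.comp fun i j h => by simpa using h))) (g := fun _ => 0)
        antitone_const fun i => mem_support_of_orderTop_eq ?_
      exact orderTop_derivation_mono_growth hx hspec
        ((order_le_growth hx _).trans_lt (hlt i)) (hχ' _)
    obtain ⟨N, hN⟩ := hfin.bddAbove
    -- Starting after `N` avoids the exceptions; the extra 1 makes every index positive, so that
    -- `growth` strictly exceeds `x.order`.
    let ρ : ℕ → ℕ := fun i => φ (ψ (N + 1 + i))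
    have hρ : StrictMono ρ := hφ.comp (hψ.comp fun i j h => by simpa using h)
    have hρβ : StrictMono fun i => growth D x (n (ρ i)) :=
      hm.comp (hψ.comp fun i j h => by simpa using h)
    have hρz : Monotone fun i => n (ρ i) + k (ρ i) • growth D x (n (ρ i)) :=
      hz.comp fun i j h => by simpa using h
    obtain ⟨i, hi⟩ := exists_monotone_of_strictMono hD hρβ hρz
      (fun i => orderTop_logDer_of_order_lt_growth
        ((order_le_growth hx _).trans_lt (hm (hψ (by omega : 0 < N + 1 + i)))))
      (fun i => by
        by_contra hcon
        exact absurd (hN hcon) (by omega))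
    have hτ : StrictMono fun j => ρ (i + 1 + j) := hρ.comp fun i j h => by simpa using h
    refine not_antitone_of_monotone_add_nsmul hΔ (hε (ρ i)) (hk.comp hτ)
      (monotone_nat_of_le_succ fun j => ?_) (hg.comp_monotone hτ.monotone) fun j => hgn _
    exact hi _ _ (by omega) (by omega)
  -- Here the first value of `growth` is the largest, and chains for a smaller `β` are also chains
  -- for a larger one.
  · obtain ⟨ψ, hψ, hz⟩ := Reaches.exists_monotone hD s.isPWO_support
      (β := fun _ => growth D x (n (φ 0))) monotone_const
      (fun i => (hreach (φ i)).mono (ha (Nat.zero_le i)))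
    exact not_antitone_of_monotone_add_nsmul hΔ (hε (φ 0)) (hk.comp (hφ.comp hψ)) hz
      (hg.comp_monotone (hφ.comp hψ).monotone) fun i => hgn _

end TaylorSummable

/-! ### Composition of convergent power series -/

section Composition

variable {Γ : Type u} [AddCommGroup Γ] [LinearOrder Γ] [IsOrderedAddMonoid Γ]
  {K : Type v} [Field K] {ι κ : Type*}

theorem seriesSum_eq_sum {s : ι → HahnSeries Γ K} (F : Finset ι) (h : ∀ i ∉ F, s i = 0) :
    seriesSum s = ∑ i ∈ F, s i := by
  have hs : IsSummable s := by
    refine ⟨((Finset.isPWO_bUnion F).2 fun i _ => (s i).isPWO_support).mono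
      (Set.iUnion_subset fun i γ hγ => ?_), fun γ => F.finite_toSet.subset fun i hi => ?_⟩
    · by_cases hi : i ∈ F
      · exact Set.mem_biUnion (t := fun i => (s i).support) hi hγ
      · simp [h i hi] at hγ
    · by_contra hi'
      exact hi (by rw [h i hi', HahnSeries.coeff_zero])
  ext γ
  rw [hs.coeff_seriesSum, HahnSeries.coeff_sum]
  refine finsum_eq_sum_of_support_subset _ fun i hi => ?_
  by_contra hi'
  exact hi (by simp only [h i hi', HahnSeries.coeff_zero])

theorem seriesSum_eq_single {s : ι → HahnSeries Γ K} (i : ι) (h : ∀ j ≠ i, s j = 0) :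
    seriesSum s = s i := by
  rw [seriesSum_eq_sum {i} fun j hj => h j (by simpa using hj), Finset.sum_singleton]

open scoped Classical in
theorem IsSummable.fiber {s : ι → HahnSeries Γ K} (h : IsSummable s) (f : ι → κ) :
    IsSummable (fun p : κ × ι => if f p.2 = p.1 then s p.2 else 0) := by
  refine ⟨h.1.mono (Set.iUnion_subset fun p γ hγ => ?_), fun γ =>
    ((h.2 γ).image fun i => (f i, i)).subset fun p hp => ?_⟩
  · dsimp only at hγ
    split_ifs at hγ
    · exact Set.mem_iUnion.2 ⟨p.2, hγ⟩
    · simp at hγ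
  · simp only [Set.mem_ofPred_eq] at hp
    split_ifs at hp with hf
    · exact ⟨p.2, hp, Prod.ext hf rfl⟩
    · simp at hp

open scoped Classical in
theorem IsSummable.seriesSum_fiber {s : ι → HahnSeries Γ K} (h : IsSummable s) (f : ι → κ) :
    seriesSum (fun k => seriesSum (fun i => if f i = k then s i else 0)) = seriesSum s := by
  rw [IsSummable.seriesSum_comm (s := fun k i => if f i = k then s i else 0) (h.fiber f)]
  congr 1
  funext i
  rw [seriesSum_eq_single (f i) fun k hk => if_neg fun h => hk h.symm, if_pos rfl]

theorem coeff_mul_eq_seriesSum (A B : PowerSeries (HahnSeries Γ K)) (k : ℕ) :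
    PowerSeries.coeff k (A * B) = seriesSum (fun p : ℕ × ℕ =>
      if p.1 + p.2 = k then PowerSeries.coeff p.1 A * PowerSeries.coeff p.2 B else 0) := by
  rw [seriesSum_eq_sum (Finset.HasAntidiagonal.antidiagonal k) fun p hp => if_neg (by simpa using hp),
    PowerSeries.coeff_mul]
  exact Finset.sum_congr rfl fun p hp => (if_pos (by simpa using hp)).symm

variable {A B Θ P : PowerSeries (HahnSeries Γ K)}

theorem isSummable_coeff_mul (hA : IsSummable fun k => PowerSeries.coeff k A)
    (hB : IsSummable fun k => PowerSeries.coeff k B) :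
    IsSummable fun k => PowerSeries.coeff k (A * B) := by
  classical
  simp only [coeff_mul_eq_seriesSum]
  convert ((hA.mul hB).fiber (fun p : ℕ × ℕ => p.1 + p.2)).prod

theorem seriesSum_coeff_mul (hA : IsSummable fun k => PowerSeries.coeff k A)
    (hB : IsSummable fun k => PowerSeries.coeff k B) :
    seriesSum (fun k => PowerSeries.coeff k (A * B)) =
      seriesSum (fun k => PowerSeries.coeff k A) * seriesSum (fun k => PowerSeries.coeff k B) := by
  classical
  rw [← hA.seriesSum_mul hB, ← (hA.mul hB).seriesSum_fiber (fun p : ℕ × ℕ => p.1 + p.2)]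
  simp only [coeff_mul_eq_seriesSum]
  congr!

theorem coeff_C_eq_zero (c : HahnSeries Γ K) {k : ℕ} (hk : k ≠ 0) :
    PowerSeries.coeff k (PowerSeries.C c) = 0 := by
  rw [PowerSeries.coeff_C, if_neg hk]

theorem isSummable_coeff_C (c : HahnSeries Γ K) :
    IsSummable fun k => PowerSeries.coeff k (PowerSeries.C c) := by
  refine isSummable_of_not_antitone fun k g hk _ hmem => ?_
  have := hmem 1
  rw [coeff_C_eq_zero c (by have := hk Nat.zero_lt_one; omega)] at this
  simp at this

theorem seriesSum_coeff_C (c : HahnSeries Γ K) :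
    seriesSum (fun k => PowerSeries.coeff k (PowerSeries.C c)) = c := by
  rw [seriesSum_eq_single 0 fun k hk => coeff_C_eq_zero c hk, PowerSeries.coeff_zero_C]

theorem isSummable_coeff_pow (hA : IsSummable fun k => PowerSeries.coeff k A) (n : ℕ) :
    IsSummable fun k => PowerSeries.coeff k (A ^ n) := by
  induction n with
  | zero => simpa only [pow_zero, map_one] using isSummable_coeff_C (1 : HahnSeries Γ K)
  | succ n ih => rw [pow_succ]; exact isSummable_coeff_mul ih hA

theorem seriesSum_coeff_pow (hA : IsSummable fun k => PowerSeries.coeff k A) (n : ℕ) :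
    seriesSum (fun k => PowerSeries.coeff k (A ^ n)) =
      seriesSum (fun k => PowerSeries.coeff k A) ^ n := by
  induction n with
  | zero => simpa only [pow_zero, map_one] using seriesSum_coeff_C (1 : HahnSeries Γ K)
  | succ n ih => rw [pow_succ, seriesSum_coeff_mul (isSummable_coeff_pow hA n) hA, ih, pow_succ]

theorem support_mul_subset_exists {s t : HahnSeries Γ K} {g : Γ} (hg : g ∈ (s * t).support) :
    ∃ a ∈ s.support, ∃ b ∈ t.support, a + b = g :=
  Set.mem_add.1 (HahnSeries.support_mul_subset hg)

theorem support_coeff_pow_subset (A : PowerSeries (HahnSeries Γ K)) (j k : ℕ) :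
    (PowerSeries.coeff k (A ^ j)).support ⊆
      AddSubmonoid.closure (⋃ k, (PowerSeries.coeff k A).support) := by
  induction j generalizing k with
  | zero =>
    intro g hg
    rw [pow_zero, PowerSeries.coeff_one] at hg
    split_ifs at hg
    · have : g = 0 := by simpa using HahnSeries.support_single_subset hg
      rw [this]; exact zero_mem _
    · simp at hg
  | succ j ih =>
    intro g hg
    rw [pow_succ, PowerSeries.coeff_mul] at hg
    obtain ⟨p, -, hp⟩ : ∃ p ∈ Finset.HasAntidiagonal.antidiagonal k,
        g ∈ (PowerSeries.coeff p.1 (A ^ j) * PowerSeries.coeff p.2 A).support := by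
      by_contra! hcon
      refine hg ?_
      rw [HahnSeries.coeff_sum]
      exact Finset.sum_eq_zero fun p hp => not_not.1 (hcon p hp)
    obtain ⟨a, ha, b, hb, rfl⟩ := support_mul_subset_exists hp
    exact add_mem (ih _ ha) (AddSubmonoid.subset_closure (Set.mem_iUnion.2 ⟨_, hb⟩))

/-- All powers of Θ have supports in the submonoid generated by a well-ordered set of non-negative
values, which is again well-ordered (Neumann). The double family is therefore controlled by the
product of `Q` with the monomials of that submonoid. -/
theorem isSummable_mul_coeff_pow {Q : ℕ → HahnSeries Γ K} (hQ : IsSummable Q)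
    (hΘ : IsSummable fun k => PowerSeries.coeff k Θ)
    (hpos : ∀ k, 0 ≤ (PowerSeries.coeff k Θ).orderTop) :
    IsSummable (fun p : ℕ × ℕ => Q p.1 * PowerSeries.coeff p.2 (Θ ^ p.1)) := by
  have hW : (AddSubmonoid.closure (⋃ k, (PowerSeries.coeff k Θ).support) : Set Γ).IsPWO := by
    refine Set.IsPWO.addSubmonoid_closure (fun g hg => ?_) hΘ.1
    obtain ⟨k, hk⟩ := Set.mem_iUnion.1 hg
    exact WithTop.coe_le_coe.1 ((hpos k).trans (HahnSeries.orderTop_le_of_coeff_ne_zero hk))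
  have hS := hQ.mul (isSummable_single hW fun _ => (1 : K))
  have key : ∀ (p : ℕ × ℕ) (g : Γ), g ∈ (Q p.1 * PowerSeries.coeff p.2 (Θ ^ p.1)).support →
      ∃ u : (AddSubmonoid.closure (⋃ k, (PowerSeries.coeff k Θ).support) : Set Γ),
        (u : Γ) ∈ (PowerSeries.coeff p.2 (Θ ^ p.1)).support ∧
        g ∈ (Q p.1 * HahnSeries.single (u : Γ) (1 : K)).support := by
    intro p g hg
    obtain ⟨a, ha, b, hb, rfl⟩ := support_mul_subset_exists hg
    refine ⟨⟨b, support_coeff_pow_subset Θ _ _ hb⟩, hb, ?_⟩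
    rw [HahnSeries.mem_support, HahnSeries.coeff_mul_single_add, mul_one]
    exact ha
  refine ⟨hS.1.mono (Set.iUnion_subset fun p g hg => ?_), fun g => ?_⟩
  · obtain ⟨u, -, h⟩ := key p g hg
    exact Set.mem_iUnion.2 ⟨(p.1, u), h⟩
  · refine ((hS.2 g).biUnion (t := fun q => (fun k => (q.1, k)) ''
      {k | (PowerSeries.coeff k (Θ ^ q.1)).coeff q.2 ≠ 0}) fun q _ =>
        ((isSummable_coeff_pow hΘ q.1).2 _).image _).subset fun p hp => ?_
    obtain ⟨u, hu, h⟩ := key p g hp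
    exact Set.mem_biUnion (x := (p.1, u)) h ⟨p.2, hu, rfl⟩

/-- Rescaling by `w` reduces to the previous situation: the coefficients of Θ/w are ≼ 1 and Pⱼwʲ is
summable. -/
theorem isSummable_coeff_mul_coeff_pow (hΘ : IsSummable fun k => PowerSeries.coeff k Θ)
    {w : HahnSeries Γ K} (hw : w ≠ 0) (hP : w ∈ convergenceSet P)
    (hdom : ∀ k, Dominated (PowerSeries.coeff k Θ) w) :
    IsSummable (fun p : ℕ × ℕ => PowerSeries.coeff p.1 P * PowerSeries.coeff p.2 (Θ ^ p.1)) := by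
  have hΘ' : ∀ k, PowerSeries.coeff k (PowerSeries.C w⁻¹ * Θ) = w⁻¹ * PowerSeries.coeff k Θ :=
    fun k => PowerSeries.coeff_C_mul _ _ _
  have h := isSummable_mul_coeff_pow (Θ := PowerSeries.C w⁻¹ * Θ) hP
    (by simp only [hΘ']; exact hΘ.mul_left _)
    (fun k => by
      rw [hΘ', mul_comm, ← div_eq_mul_inv]
      exact orderTop_div_nonneg hw (hdom k))
  convert h using 2 with p
  rw [mul_pow, ← map_pow, PowerSeries.coeff_C_mul, mul_assoc, ← mul_assoc (w ^ p.1), ← mul_pow,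
    mul_inv_cancel₀ hw, one_pow, one_mul]

theorem seriesSum_coeff_subst (h0 : PowerSeries.constantCoeff Θ = 0) (k : ℕ) :
    seriesSum (fun j => PowerSeries.coeff j P * PowerSeries.coeff k (Θ ^ j)) =
      PowerSeries.coeff k (P.subst Θ) := by
  have hz : ∀ j ∉ Finset.range (k + 1), PowerSeries.coeff k (Θ ^ j) = 0 := fun j hj =>
    PowerSeries.coeff_of_lt_order _ (lt_of_lt_of_le (by
      rw [Finset.mem_range] at hj
      exact_mod_cast (by omega : k < j)) (PowerSeries.le_order_pow_of_constantCoeff_eq_zero j h0))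
  rw [PowerSeries.coeff_subst' (PowerSeries.HasSubst.of_constantCoeff_zero' h0),
    seriesSum_eq_sum (Finset.range (k + 1)) fun j hj => by rw [hz j hj, mul_zero]]
  refine (finsum_eq_sum_of_support_subset _ fun j hj => ?_).symm
  by_contra hj'
  exact hj (by simp only [hz j hj', mul_zero])

/-- The value of a convergent power series at the sum of a summable family of series, by
substitution of formal power series. -/
theorem evalSeries_seriesSum (h0 : PowerSeries.constantCoeff Θ = 0)
    (hΘ : IsSummable fun k => PowerSeries.coeff k Θ) {w : HahnSeries Γ K} (hw : w ≠ 0)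
    (hP : w ∈ convergenceSet P) (hdom : ∀ k, Dominated (PowerSeries.coeff k Θ) w) :
    evalSeries P (seriesSum fun k => PowerSeries.coeff k Θ) =
      seriesSum (fun k => PowerSeries.coeff k (P.subst Θ)) := by
  have h := isSummable_coeff_mul_coeff_pow hΘ hw hP hdom
  simp only [← seriesSum_coeff_subst h0]
  rw [← IsSummable.seriesSum_comm
    (s := fun j k => PowerSeries.coeff j P * PowerSeries.coeff k (Θ ^ j)) h, evalSeries]
  congr 1
  funext j
  rw [(isSummable_coeff_pow hΘ j).seriesSum_mul_left, seriesSum_coeff_pow hΘ]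

end Composition

/-! ### Taylor expansions as formal power series -/

section TaylorSeries

variable {Γ : Type u} [AddCommGroup Γ] [LinearOrder Γ] [IsOrderedAddMonoid Γ]
  {Γ' : Type u'} [AddCommGroup Γ'] [LinearOrder Γ'] [IsOrderedAddMonoid Γ']
  {K : Type v} [Field K] [CharZero K]
  (D : Derivation K (HahnSeries Γ K) (HahnSeries Γ K))
  (Δ : HahnSeries Γ K →ₐ[K] HahnSeries Γ' K) (δ : HahnSeries Γ' K)

/-- The formal power series whose coefficients are the terms of the Taylor expansion at `s`. -/
def taylorPowerSeries (s : HahnSeries Γ K) : PowerSeries (HahnSeries Γ' K) :=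
  PowerSeries.mk (taylorTerm D Δ δ s)

instance : CharZero (HahnSeries Γ K) :=
  charZero_of_injective_algebraMap (algebraMap K (HahnSeries Γ K)).injective

theorem taylorTerm_zero (s : HahnSeries Γ K) : taylorTerm D Δ δ s 0 = Δ s := by
  simp [taylorTerm]

theorem natCast_smul_eq (n : ℕ) (t : HahnSeries Γ K) : (n : K) • t = n * t := by
  rw [Nat.cast_smul_eq_nsmul, nsmul_eq_mul]

theorem taylorTerm_succ_mul (s : HahnSeries Γ K) (k : ℕ) :
    taylorTerm D Δ δ s (k + 1) * ((k : HahnSeries Γ' K) + 1) = δ * taylorTerm D Δ δ (D s) k := by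
  have hk : ((k + 1 : ℕ) : K) ≠ 0 := by exact_mod_cast Nat.succ_ne_zero k
  rw [taylorTerm, taylorTerm, Function.iterate_succ_apply, mul_comm,
    ← Nat.cast_succ, ← natCast_smul_eq, smul_smul, Nat.factorial_succ, Nat.cast_mul, mul_inv,
    ← mul_assoc, mul_inv_cancel₀ hk, one_mul, pow_succ, mul_smul_comm]
  congr 1; ring

theorem derivative_taylorPowerSeries (s : HahnSeries Γ K) :
    PowerSeries.derivative (HahnSeries Γ' K) (taylorPowerSeries D Δ δ s) =
      PowerSeries.C δ * taylorPowerSeries D Δ δ (D s) := by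
  ext1 k
  rw [PowerSeries.coeff_derivative, PowerSeries.coeff_C_mul, taylorPowerSeries, taylorPowerSeries,
    PowerSeries.coeff_mk, PowerSeries.coeff_mk, taylorTerm_succ_mul]

theorem constantCoeff_taylorPowerSeries (s : HahnSeries Γ K) :
    PowerSeries.constantCoeff (taylorPowerSeries D Δ δ s) = Δ s := by
  rw [← PowerSeries.coeff_zero_eq_constantCoeff_apply, taylorPowerSeries, PowerSeries.coeff_mk,
    taylorTerm_zero]

theorem iterate_derivation_add (k : ℕ) (s t : HahnSeries Γ K) :
    (fun t => D t)^[k] (s + t) = (fun t => D t)^[k] s + (fun t => D t)^[k] t := by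
  induction k generalizing s t with
  | zero => rfl
  | succ k ih => simp only [Function.iterate_succ_apply, map_add, ih]

theorem taylorPowerSeries_add (s t : HahnSeries Γ K) :
    taylorPowerSeries D Δ δ (s + t) = taylorPowerSeries D Δ δ s + taylorPowerSeries D Δ δ t := by
  ext1 k
  simp only [taylorPowerSeries, PowerSeries.coeff_mk, map_add, taylorTerm,
    iterate_derivation_add, add_mul, smul_add]

variable {D Δ δ}

theorem coeff_succ_eq_of_derivative {F G : PowerSeries (HahnSeries Γ K)} {k : ℕ}
    (h : PowerSeries.coeff k (PowerSeries.derivative (HahnSeries Γ K) F) =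
      PowerSeries.coeff k (PowerSeries.derivative (HahnSeries Γ K) G)) :
    PowerSeries.coeff (k + 1) F = PowerSeries.coeff (k + 1) G := by
  rw [PowerSeries.coeff_derivative, PowerSeries.coeff_derivative] at h
  exact mul_right_cancel₀ (by exact_mod_cast Nat.succ_ne_zero k) h

/-- Both sides have the same constant coefficient and satisfy the same recursion under formal
differentiation, which is δ times the operation s ↦ s'. -/
theorem taylorPowerSeries_mul (s t : HahnSeries Γ K) :
    taylorPowerSeries D Δ δ (s * t) = taylorPowerSeries D Δ δ s * taylorPowerSeries D Δ δ t := by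
  ext1 k
  induction k generalizing s t with
  | zero => simp [constantCoeff_taylorPowerSeries]
  | succ k ih =>
    refine coeff_succ_eq_of_derivative ?_
    rw [Derivation.leibniz, derivative_taylorPowerSeries, derivative_taylorPowerSeries,
      derivative_taylorPowerSeries, Derivation.leibniz, smul_eq_mul, smul_eq_mul, smul_eq_mul,
      smul_eq_mul, taylorPowerSeries_add, mul_left_comm, mul_left_comm _ (PowerSeries.C δ),
      ← mul_add, PowerSeries.coeff_C_mul, PowerSeries.coeff_C_mul, map_add, map_add, ih, ih]

/-- Formal Taylor formula. By the chain rule, both derivatives are δ times the series of s' times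
the corresponding side for n + 1, so the coefficients agree by strong induction on their degree,
simultaneously for all n. -/
theorem taylorPowerSeries_eq_subst {s : HahnSeries Γ K} {a : ℕ → HahnSeries Γ K}
    (ha : ∀ n, D (a n) = D s * a (n + 1)) (n : ℕ) :
    taylorPowerSeries D Δ δ (a n) =
      (PowerSeries.mk fun j => ((j.factorial : K)⁻¹) • Δ (a (n + j))).subst
        (taylorPowerSeries D Δ δ s - PowerSeries.C (Δ s)) := by
  have h0 : PowerSeries.constantCoeff (taylorPowerSeries D Δ δ s - PowerSeries.C (Δ s)) = 0 := by
    rw [map_sub, constantCoeff_taylorPowerSeries, PowerSeries.constantCoeff_C, sub_self]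
  have hsub := PowerSeries.HasSubst.of_constantCoeff_zero' h0
  ext1 k
  induction k using Nat.strong_induction_on generalizing n with
  | _ k ih =>
    rcases k with - | k
    · rw [← seriesSum_coeff_subst h0, seriesSum_eq_single 0]
      · simp [constantCoeff_taylorPowerSeries]
      · intro j hj
        simp [h0, hj]
    · refine coeff_succ_eq_of_derivative ?_
      have hd : PowerSeries.derivative (HahnSeries Γ' K)
          (PowerSeries.mk fun j => ((j.factorial : K)⁻¹) • Δ (a (n + j))) =
          PowerSeries.mk fun j => ((j.factorial : K)⁻¹) • Δ (a (n + 1 + j)) := by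
        ext1 j
        have hj : ((j + 1 : ℕ) : K) ≠ 0 := by exact_mod_cast Nat.succ_ne_zero j
        rw [PowerSeries.coeff_derivative, PowerSeries.coeff_mk, PowerSeries.coeff_mk, mul_comm,
          ← Nat.cast_succ, ← natCast_smul_eq, smul_smul, Nat.factorial_succ, Nat.cast_mul,
          mul_inv, ← mul_assoc, mul_inv_cancel₀ hj, one_mul, add_assoc n 1, add_comm 1 j]
      rw [PowerSeries.derivative_subst hsub, hd, map_sub, PowerSeries.derivative_C, sub_zero,
        derivative_taylorPowerSeries, derivative_taylorPowerSeries, ha, taylorPowerSeries_mul,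
        mul_comm (taylorPowerSeries D Δ δ (D s)), mul_left_comm (PowerSeries.subst _ _),
        PowerSeries.coeff_C_mul, PowerSeries.coeff_C_mul, PowerSeries.coeff_mul,
        PowerSeries.coeff_mul]
      congr 1
      refine Finset.sum_congr rfl fun p hp => ?_
      rw [ih p.1 (by have := Finset.HasAntidiagonal.mem_antidiagonal.1 hp; omega) (n + 1)]

/-- Compatibility of a Taylor deformation with a function whose iterated derivatives at `s`
are `a 0, a 1, …`. -/
theorem taylorDeformation_eq_evalSeries {s : HahnSeries Γ K} {a : ℕ → HahnSeries Γ K}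
    (ha : ∀ n, D (a n) = D s * a (n + 1)) (hs : IsSummable (taylorTerm D Δ δ s))
    {w : HahnSeries Γ' K} (hw : w ≠ 0)
    (hP : w ∈ convergenceSet (PowerSeries.mk fun j => ((j.factorial : K)⁻¹) • Δ (a j)))
    (hdom : ∀ k ≠ 0, Dominated (taylorTerm D Δ δ s k) w) :
    taylorDeformation D Δ δ (a 0) =
      evalSeries (PowerSeries.mk fun j => ((j.factorial : K)⁻¹) • Δ (a j))
        (taylorDeformation D Δ δ s - Δ s) := by
  have h0 : PowerSeries.constantCoeff (taylorPowerSeries D Δ δ s + PowerSeries.C (-Δ s)) = 0 := by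
    -- Removing Δ(s) makes the inner series substitutable; it only affects the coefficient of degree
    -- 0, which is why `hdom` is needed for k ≠ 0 alone.
    rw [map_add, constantCoeff_taylorPowerSeries, PowerSeries.constantCoeff_C, add_neg_cancel]
  have hs' : IsSummable fun k => PowerSeries.coeff k (taylorPowerSeries D Δ δ s) := by
    simpa only [taylorPowerSeries, PowerSeries.coeff_mk] using hs
  have h := evalSeries_seriesSum h0
    (by simpa only [map_add] using hs'.add (isSummable_coeff_C (-Δ s))) hw hP (fun k => by
      rcases eq_or_ne k 0 with rfl | hk
      · rw [PowerSeries.coeff_zero_eq_constantCoeff_apply, h0, Dominated, HahnSeries.orderTop_zero]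
        exact le_top
      · rw [map_add, coeff_C_eq_zero _ hk, add_zero, taylorPowerSeries, PowerSeries.coeff_mk]
        exact hdom k hk)
  have h1 := taylorPowerSeries_eq_subst (Δ := Δ) (δ := δ) ha 0
  simp only [zero_add, sub_eq_add_neg, ← map_neg PowerSeries.C] at h1
  rw [← h1] at h
  simp only [map_add] at h
  rw [hs'.seriesSum_add (isSummable_coeff_C (-Δ s)), seriesSum_coeff_C] at h
  simp only [taylorPowerSeries, PowerSeries.coeff_mk, ← sub_eq_add_neg] at h
  exact h.symm

end TaylorSeries

/-! ### Taylor coefficients of analytic functions -/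

section Convergence

variable {Γ : Type u} [AddCommGroup Γ] [LinearOrder Γ] [IsOrderedAddMonoid Γ]
  {K : Type v} [Field K] {ι κ : Type*} {P : PowerSeries (HahnSeries Γ K)}
  {ρ ε : HahnSeries Γ K}

theorem IsSummable.seriesSum_comp_of_injective {s : ι → HahnSeries Γ K} (h : IsSummable s)
    {f : κ → ι} (hf : Function.Injective f) (h0 : ∀ i ∉ Set.range f, s i = 0) :
    seriesSum (fun k => s (f k)) = seriesSum s := by
  have := HahnSeries.SummableFamily.hsum_embDomain (s := (h.comp_injective hf).family)
    (f := (⟨f, hf⟩ : κ ↪ ι))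
  rw [(h.comp_injective hf).hsum_family, ← seriesSum_coe] at this
  rw [← this]
  congr 1
  funext i
  by_cases hi : i ∈ Set.range f
  · obtain ⟨k, rfl⟩ := hi
    exact HahnSeries.SummableFamily.embDomain_image (h.comp_injective hf).family ⟨f, hf⟩
  · rw [HahnSeries.SummableFamily.embDomain_of_notMem_range _ ⟨f, hf⟩ hi, h0 i hi]

theorem IsSummable.sub {s t : ι → HahnSeries Γ K} (hs : IsSummable s) (ht : IsSummable t) :
    IsSummable (fun i => s i - t i) :=
  isSummable_coe (hs.family - ht.family)

theorem IsSummable.seriesSum_sub {s t : ι → HahnSeries Γ K} (hs : IsSummable s)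
    (ht : IsSummable t) : seriesSum (fun i => s i - t i) = seriesSum s - seriesSum t := by
  have := seriesSum_coe (hs.family - ht.family)
  rw [HahnSeries.SummableFamily.hsum_sub, hs.hsum_family, ht.hsum_family] at this
  exact this

theorem isSummable_mul_pow {Q : ℕ → HahnSeries Γ K} (hQ : IsSummable Q) {θ : HahnSeries Γ K}
    (hθ : 0 ≤ θ.orderTop) : IsSummable (fun j => Q j * θ ^ j) := by
  have h := isSummable_mul_coeff_pow hQ (isSummable_coeff_C θ) fun k => by
    rcases eq_or_ne k 0 with rfl | hk
    · rwa [PowerSeries.coeff_zero_C]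
    · rw [coeff_C_eq_zero _ hk, HahnSeries.orderTop_zero]; exact le_top
  have h' := h.comp_injective (f := fun j : ℕ => (j, 0)) fun i j h => congrArg Prod.fst h
  simpa only [← map_pow, PowerSeries.coeff_zero_C] using h'

theorem mem_convergenceSet_of_dominated (hρ : ρ ≠ 0) (h : ρ ∈ convergenceSet P)
    (hε : Dominated ε ρ) : ε ∈ convergenceSet P := by
  have h1 := isSummable_mul_pow h (orderTop_div_nonneg hρ hε)
  simp only [mul_assoc, ← mul_pow, mul_div_cancel₀ _ hρ] at h1
  exact h1

/-- Up to the factor ρ⁻¹ and integer scalars, which do not enlarge supports, these are the terms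
Pⱼρʲ. The truncated exponent at j = 0 is harmless since the factor j vanishes. -/
theorem isSummable_mul_natCast_mul_pow (hρ : ρ ≠ 0) (h : ρ ∈ convergenceSet P) :
    IsSummable (fun j : ℕ => PowerSeries.coeff j P * ((j : HahnSeries Γ K) * ρ ^ (j - 1))) := by
  refine (h.mul_left ρ⁻¹).of_support_subset fun j => ?_
  rcases j with - | j
  · simp
  · have : PowerSeries.coeff (j + 1) P * (((j + 1 : ℕ) : HahnSeries Γ K) * ρ ^ (j + 1 - 1)) =
        ((j + 1 : ℕ) : K) • (ρ⁻¹ * (PowerSeries.coeff (j + 1) P * ρ ^ (j + 1))) := by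
      rw [Nat.cast_smul_eq_nsmul, nsmul_eq_mul, pow_succ, Nat.add_sub_cancel]
      field_simp
    rw [this]
    exact HahnSeries.support_smul_subset _ _

theorem isSummable_mul_natCast_mul_pow_of_dominated (hρ : ρ ≠ 0) (h : ρ ∈ convergenceSet P)
    (hε : Dominated ε ρ) : IsSummable
      (fun j : ℕ => PowerSeries.coeff j P * ((j : HahnSeries Γ K) * ε ^ (j - 1))) := by
  by_cases h0 : ε = 0
  · refine isSummable_of_not_antitone fun k g hk _ hmem => ?_
    have := hmem 2
    have h2 : 2 ≤ k 2 := hk.le_apply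
    rw [h0, zero_pow (by omega), mul_zero, mul_zero] at this
    simp at this
  · exact isSummable_mul_natCast_mul_pow h0 (mem_convergenceSet_of_dominated hρ h hε)

theorem mem_convergenceSet_derivative (hρ : ρ ≠ 0) (h : ρ ∈ convergenceSet P) :
    ρ ∈ convergenceSet (PowerSeries.derivative (HahnSeries Γ K) P) := by
  have h1 := (isSummable_mul_natCast_mul_pow hρ h).comp_injective Nat.succ_injective
  rw [convergenceSet, Set.mem_ofPred_eq]
  convert h1 using 2 with j
  rw [PowerSeries.coeff_derivative, Nat.succ_eq_add_one, Nat.add_sub_cancel, Nat.cast_succ,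
    mul_assoc]

theorem evalSeries_derivative
    (h : IsSummable (fun j : ℕ => PowerSeries.coeff j P * ((j : HahnSeries Γ K) * ε ^ (j - 1)))) :
    evalSeries (PowerSeries.derivative (HahnSeries Γ K) P) ε =
      seriesSum (fun j : ℕ => PowerSeries.coeff j P * ((j : HahnSeries Γ K) * ε ^ (j - 1))) := by
  rw [← h.seriesSum_comp_of_injective Nat.succ_injective, evalSeries]
  · congr 1
    funext j
    rw [PowerSeries.coeff_derivative, Nat.succ_eq_add_one, Nat.add_sub_cancel, Nat.cast_succ,
      mul_assoc]
  · intro i hi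
    rcases i with - | i
    · simp
    · exact absurd ⟨i, rfl⟩ hi

theorem IsSummable.exists_le_orderTop {s : ι → HahnSeries Γ K} (h : IsSummable s) :
    ∃ c : Γ, ∀ i, (c : WithTop Γ) ≤ (s i).orderTop := by
  by_cases hne : (⋃ i, (s i).support).Nonempty
  · refine ⟨h.1.isWF.min hne, fun i => ?_⟩
    by_cases hi : s i = 0
    · rw [hi, HahnSeries.orderTop_zero]; exact le_top
    · obtain ⟨g, hg⟩ := exists_orderTop_eq hi
      rw [hg, WithTop.coe_le_coe]
      exact h.1.isWF.min_le hne (Set.mem_iUnion.2 ⟨i, mem_support_of_orderTop_eq hg⟩)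
  · refine ⟨0, fun i => ?_⟩
    have : s i = 0 := HahnSeries.support_eq_empty_iff.1
      (Set.subset_eq_empty (Set.subset_iUnion (fun i => (s i).support) i)
        (Set.not_nonempty_iff_eq_empty.1 hne))
    rw [this, HahnSeries.orderTop_zero]; exact le_top

theorem orderTop_natCast_nonneg (n : ℕ) : 0 ≤ ((n : ℕ) : HahnSeries Γ K).orderTop := by
  have := orderTop_C_nonneg (Γ := Γ) (n : K)
  rwa [map_natCast] at this

theorem orderTop_pow_nonneg {e : HahnSeries Γ K} (he : 0 ≤ e.orderTop) (n : ℕ) :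
    0 ≤ (e ^ n).orderTop := by
  rw [orderTop_pow]; exact nsmul_nonneg he n

theorem orderTop_mul_nonneg {e h : HahnSeries Γ K} (he : 0 ≤ e.orderTop) (hh : 0 ≤ h.orderTop) :
    0 ≤ (e * h).orderTop := by
  rw [HahnSeries.orderTop_mul]; exact add_nonneg he hh

theorem orderTop_add_nonneg {e h : HahnSeries Γ K} (he : 0 ≤ e.orderTop) (hh : 0 ≤ h.orderTop) :
    0 ≤ (e + h).orderTop :=
  (le_min he hh).trans HahnSeries.min_orderTop_le_orderTop_add

theorem exists_add_pow_eq {e h : HahnSeries Γ K} (he : 0 ≤ e.orderTop) (hh : 0 ≤ h.orderTop)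
    (n : ℕ) : ∃ r : HahnSeries Γ K, 0 ≤ r.orderTop ∧
      (e + h) ^ n = e ^ n + n * e ^ (n - 1) * h + h ^ 2 * r := by
  induction n with
  | zero => exact ⟨0, by simp, by simp⟩
  | succ n ih =>
    obtain ⟨r, hr, hn⟩ := ih
    refine ⟨r * (e + h) + n * e ^ (n - 1), orderTop_add_nonneg
      (orderTop_mul_nonneg hr (orderTop_add_nonneg he hh))
      (orderTop_mul_nonneg (orderTop_natCast_nonneg n) (orderTop_pow_nonneg he _)), ?_⟩
    rw [pow_succ, hn]
    rcases n with - | n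
    · simp; ring
    · simp only [Nat.add_sub_cancel]; push_cast; ring

/-- Termwise differentiation of a convergent power series. -/
theorem exists_dominated_evalSeries_add (hρ : ρ ≠ 0) (hP : ρ ∈ convergenceSet P) :
    ∃ w : HahnSeries Γ K, w ≠ 0 ∧ ∀ ε h, Dominated ε ρ → Dominated h ρ →
      Dominated (evalSeries P (ε + h) - evalSeries P ε -
        h * evalSeries (PowerSeries.derivative (HahnSeries Γ K) P) ε) (h ^ 2 * w) := by
  obtain ⟨c, hc⟩ := IsSummable.exists_le_orderTop hP
  -- In the variables ε/ρ and h/ρ, both ≼ 1, the remainder of each binomial expansion is (h/ρ)²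
  -- times something ≼ 1; `c` is a common lower bound for the values of the terms Pⱼρʲ.
  refine ⟨mono K c * (ρ⁻¹) ^ 2, mul_ne_zero (mono_ne_zero c) (pow_ne_zero _ (inv_ne_zero hρ)),
    fun ε h hε hh => ?_⟩
  have hconv := fun {t : HahnSeries Γ K} (ht : Dominated t ρ) =>
    mem_convergenceSet_of_dominated hρ hP ht
  have hsum : Dominated (ε + h) ρ :=
    (le_min hε hh).trans HahnSeries.min_orderTop_le_orderTop_add
  have hd : IsSummable
      (fun j : ℕ => PowerSeries.coeff j P * ((j : HahnSeries Γ K) * ε ^ (j - 1))) :=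
    isSummable_mul_natCast_mul_pow_of_dominated hρ hP hε
  rw [evalSeries_derivative hd, ← hd.seriesSum_mul_left, evalSeries, evalSeries,
    ← IsSummable.seriesSum_sub (hconv hsum) (hconv hε),
    ← (IsSummable.sub (hconv hsum) (hconv hε)).seriesSum_sub (hd.mul_left h)]
  refine le_orderTop_seriesSum fun j => ?_
  obtain ⟨r, hr, hj⟩ := exists_add_pow_eq (orderTop_div_nonneg hρ hε) (orderTop_div_nonneg hρ hh) j
  have key : PowerSeries.coeff j P * (ε + h) ^ j - PowerSeries.coeff j P * ε ^ j -
      h * (PowerSeries.coeff j P * ((j : HahnSeries Γ K) * ε ^ (j - 1))) =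
      (PowerSeries.coeff j P * ρ ^ j) * ((h / ρ) ^ 2 * r) := by
    have h1 : ε = ρ * (ε / ρ) := (mul_div_cancel₀ _ hρ).symm
    have h2 : h = ρ * (h / ρ) := (mul_div_cancel₀ _ hρ).symm
    generalize ε / ρ = e at h1 hj
    generalize h / ρ = k at h2 hj ⊢
    rw [h1, h2, ← mul_add, mul_pow, hj]
    rcases j with - | j
    · simp only [pow_zero, Nat.cast_zero]; ring
    · rw [Nat.add_sub_cancel]; ring
  calc (h ^ 2 * (mono K c * ρ⁻¹ ^ 2)).orderTop
      = c + ((h / ρ) ^ 2).orderTop := by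
        rw [mul_left_comm, HahnSeries.orderTop_mul, orderTop_mono, ← mul_pow, ← div_eq_mul_inv]
    _ ≤ (PowerSeries.coeff j P * ρ ^ j).orderTop + ((h / ρ) ^ 2 * r).orderTop := by
        refine add_le_add (hc j) ?_
        rw [HahnSeries.orderTop_mul]
        exact le_add_of_nonneg_right hr
    _ = _ := by rw [key, HahnSeries.orderTop_mul (_ * ρ ^ j)]

end Convergence

/-! ### Arbitrarily small monomials -/

section Valuation

variable {Γ : Type u} [AddCommGroup Γ] [LinearOrder Γ] [IsOrderedAddMonoid Γ] [Nontrivial Γ]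
  {K : Type v} [Field K]

theorem exists_coe_gt {t : HahnSeries Γ K} (ht : t ≠ 0) :
    ∃ g : Γ, ∀ g' ≥ g, t.orderTop < (g' : WithTop Γ) := by
  obtain ⟨a, ha⟩ := exists_orderTop_eq ht
  obtain ⟨g, hg⟩ := exists_gt a
  exact ⟨g, fun g' hg' => by rw [ha]; exact WithTop.coe_lt_coe.2 (hg.trans_le hg')⟩

end Valuation

/-! ### Uniqueness of Taylor coefficients -/

section Uniqueness

variable {Γ : Type u} [AddCommGroup Γ] [LinearOrder Γ] [IsOrderedAddMonoid Γ]
  {K : Type v} [Field K] [LinearOrder K]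

theorem ne_zero_of_mem_positive {s : HahnSeries Γ K} (hs : s ∈ positive Γ K) : s ≠ 0 := by
  rintro rfl
  simp [positive] at hs

theorem add_mem_positive {s ε : HahnSeries Γ K} (hs : s ∈ positive Γ K)
    (hε : StrictlyDominated ε s) : s + ε ∈ positive Γ K := by
  rw [positive, Set.mem_ofPred_eq, HahnSeries.leadingCoeff_add_eq_left hε]
  exact hs

variable [Nontrivial Γ] {f f' : positive Γ K → HahnSeries Γ K} {s : positive Γ K}
  {P : PowerSeries (HahnSeries Γ K)}

theorem IsTaylorSeriesAt.constantCoeff_eq (h : IsTaylorSeriesAt f s P) :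
    PowerSeries.coeff 0 P = f s := by
  obtain ⟨ρ, -, -, hf⟩ := h
  have h0 := hf 0 (by rw [Dominated, HahnSeries.orderTop_zero]; exact le_top)
    (by rw [add_zero]; exact s.2)
  rw [evalSeries, seriesSum_eq_single 0 fun k hk => by rw [zero_pow hk, mul_zero], pow_zero,
    mul_one] at h0
  rw [← h0]
  congr
  exact add_zero _

/-- Near s + ε, the derivative of f and the termwise derivative of P both linearise f. Were their
difference d non-zero, a small enough increment h would give h·d as a difference of two errors, each
≺ h·d. -/
theorem IsTaylorSeriesAt.derivative (h : IsTaylorSeriesAt f s P) (hf' : IsDerivativeOf f' f) :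
    IsTaylorSeriesAt f' s (PowerSeries.derivative (HahnSeries Γ K) P) := by
  obtain ⟨ρ, hρP, hρ, hf⟩ := h
  obtain ⟨g₁, hg₁⟩ := exists_coe_gt hρ
  obtain ⟨g₂, hg₂⟩ := exists_coe_gt (ne_zero_of_mem_positive s.2)
  obtain ⟨w, hw, hdiff⟩ := exists_dominated_evalSeries_add hρ hρP
  have hρ' : ∀ t : HahnSeries Γ K, ((max g₁ g₂ : Γ) : WithTop Γ) ≤ t.orderTop →
      Dominated t ρ ∧ (s : HahnSeries Γ K) + t ∈ positive Γ K := fun t ht =>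
    ⟨((hg₁ _ (le_max_left _ _)).le.trans ht), add_mem_positive s.2
      ((hg₂ _ (le_max_right _ _)).trans_le ht)⟩
  refine ⟨mono K (max g₁ g₂), mem_convergenceSet_of_dominated hρ
    (mem_convergenceSet_derivative hρ hρP) (hρ' _ (orderTop_mono _).ge).1, mono_ne_zero _,
    fun ε hε hεs => ?_⟩
  rw [Dominated, orderTop_mono] at hε
  by_contra hne
  set d := f' ⟨s + ε, hεs⟩ - evalSeries (PowerSeries.derivative (HahnSeries Γ K) P) ε with hd
  have hd0 : d ≠ 0 := sub_ne_zero.2 hne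
  obtain ⟨g₃, hg₃⟩ := exists_coe_gt hd0
  obtain ⟨ρ₂, hρ₂, hy⟩ := hf' ⟨s + ε, hεs⟩ (mono K g₃) (mono_ne_zero _)
  obtain ⟨g₄, hg₄⟩ := exists_coe_gt hρ₂
  obtain ⟨g₅, hg₅⟩ := exists_coe_gt (div_ne_zero hd0 hw)
  -- The bounds keep ε + h within the convergence disc and s + ε + h positive (g₁, g₂), h within the
  -- range of the derivative estimate (g₄), and h²w ≺ h·d (g₅).
  set h : HahnSeries Γ K := mono K (max (max g₁ g₂) (max g₄ g₅)) with hh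
  have hh0 : h ≠ 0 := mono_ne_zero _
  have hh1 : ((max g₁ g₂ : Γ) : WithTop Γ) ≤ h.orderTop := by
    rw [hh, orderTop_mono, WithTop.coe_le_coe]; exact le_max_left _ _
  have hεh : (s : HahnSeries Γ K) + (ε + h) ∈ positive Γ K :=
    (hρ' _ ((le_min hε hh1).trans HahnSeries.min_orderTop_le_orderTop_add)).2
  have hsub : (s : HahnSeries Γ K) + (ε + h) - (s + ε) = h := by ring
  have h1 := hy ⟨s + (ε + h), hεh⟩ (by
    simp only [hsub]
    refine (hg₄ _ ?_).le.trans (orderTop_mono (K := K) _).ge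
    exact (le_max_left _ _).trans (le_max_right _ _))
  simp only [hsub] at h1
  have h2 := hdiff ε h (hρ' ε hε).1 (hρ' h hh1).1
  rw [← hf _ ((le_min (hρ' ε hε).1 (hρ' h hh1).1).trans
    HahnSeries.min_orderTop_le_orderTop_add) hεh, ← hf ε (hρ' ε hε).1 hεs] at h2
  have h3 : (h * d).orderTop < (h * mono K g₃).orderTop := by
    rw [HahnSeries.orderTop_mul, HahnSeries.orderTop_mul, orderTop_mono g₃]
    exact WithTop.add_lt_add_left (HahnSeries.orderTop_ne_top.2 hh0) (hg₃ _ le_rfl)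
  have h4 : (h * d).orderTop < (h ^ 2 * w).orderTop := by
    rw [pow_two, mul_assoc, HahnSeries.orderTop_mul, HahnSeries.orderTop_mul]
    refine WithTop.add_lt_add_left (HahnSeries.orderTop_ne_top.2 hh0) ?_
    have h5 : (d / w).orderTop < h.orderTop := by
      rw [hh, orderTop_mono]
      exact hg₅ _ ((le_max_right _ _).trans (le_max_right _ _))
    calc d.orderTop = (d / w).orderTop + w.orderTop := by
          rw [← HahnSeries.orderTop_mul, div_mul_cancel₀ _ hw]
      _ < h.orderTop + w.orderTop :=
          WithTop.add_lt_add_right (HahnSeries.orderTop_ne_top.2 hw) h5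
      _ = (h * w).orderTop := (HahnSeries.orderTop_mul _ _).symm
  have h6 : h * d = (f ⟨s + (ε + h), hεh⟩ - f ⟨s + ε, hεs⟩ -
      h * evalSeries (PowerSeries.derivative (HahnSeries Γ K) P) ε) -
      (f ⟨s + (ε + h), hεh⟩ - f ⟨s + ε, hεs⟩ - h * f' ⟨s + ε, hεs⟩) := by
    rw [hd]; ring
  have h7 : min (h ^ 2 * w).orderTop (h * mono K g₃).orderTop ≤ (h * d).orderTop := by
    rw [h6]
    exact (min_le_min h2 h1).trans HahnSeries.min_orderTop_le_orderTop_sub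
  exact absurd h7 (not_le.2 (lt_min h4 h3))

/-- The coefficients of a Taylor series are given by the iterated derivatives. -/
theorem IsTaylorSeriesAt.eq_mk [CharZero K] (h : IsTaylorSeriesAt f s P)
    {F : ℕ → positive Γ K → HahnSeries Γ K} (hF0 : F 0 = f)
    (hF : ∀ n, IsDerivativeOf (F (n + 1)) (F n)) :
    P = PowerSeries.mk fun j => ((j.factorial : K)⁻¹) • F j s := by
  have h1 : ∀ n, IsTaylorSeriesAt (F n) s ((PowerSeries.derivative (HahnSeries Γ K))^[n] P) := by
    intro n
    induction n with
    | zero => rw [hF0]; exact h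
    | succ n ih => rw [Function.iterate_succ_apply']; exact ih.derivative (hF n)
  ext1 n
  have h2 := (h1 n).constantCoeff_eq
  have hn : (n.factorial : K) ≠ 0 := by exact_mod_cast n.factorial_ne_zero
  rw [PowerSeries.coeff_zero_eq_constantCoeff_apply,
    PowerSeries.constantCoeff_iterate_derivative, ← natCast_smul_eq] at h2
  rw [PowerSeries.coeff_mk, ← h2, smul_smul, inv_mul_cancel₀ hn, one_smul]

end Uniqueness

/-! ### Series over a subgroup of monomials -/

section Inclusion

variable {Γ : Type u} [AddCommGroup Γ] [LinearOrder Γ] [IsOrderedAddMonoid Γ]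
  {K : Type v} [Field K] {H : AddSubgroup Γ}

theorem support_incl_subset (s : HahnSeries H K) : (incl s).support ⊆ H := by
  intro γ hγ
  obtain ⟨a, -, rfl⟩ := HahnSeries.support_embDomain_subset hγ
  exact a.2

theorem coeff_incl (s : HahnSeries H K) (a : H) : (incl s).coeff (a : Γ) = s.coeff a :=
  HahnSeries.embDomain_coeff (f := ⟨⟨H.subtype, Subtype.coe_injective⟩, Iff.rfl⟩)

theorem leadingCoeff_eq_coeff {x : HahnSeries Γ K} {g : Γ} (h : x.orderTop = g) :
    x.leadingCoeff = x.coeff g := by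
  have hx : x ≠ 0 := by rintro rfl; simp at h
  rw [HahnSeries.leadingCoeff_eq]
  rw [← HahnSeries.order_eq_orderTop_of_ne_zero hx, WithTop.coe_inj] at h
  rw [h]

theorem leadingCoeff_incl (s : HahnSeries H K) : (incl s).leadingCoeff = s.leadingCoeff := by
  by_cases hs : s = 0
  · simp [hs]
  · obtain ⟨g, hg⟩ := exists_orderTop_eq hs
    have h : (incl s).orderTop = ((g : Γ) : WithTop Γ) := by
      refine (HahnSeries.orderTop_embDomain
        (f := ⟨⟨H.subtype, Subtype.coe_injective⟩, Iff.rfl⟩)).trans ?_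
      rw [hg]; rfl
    rw [leadingCoeff_eq_coeff h, leadingCoeff_eq_coeff hg, coeff_incl]

theorem incl_mem_positive [LinearOrder K] {s : HahnSeries H K} (hs : s ∈ positive H K) :
    incl s ∈ positive Γ K := by
  rw [positive, Set.mem_ofPred_eq, leadingCoeff_incl]; exact hs

end Inclusion

/-! ### The Taylor expansion is dominated by its first term -/

section Dominance

variable {Γ : Type u} [AddCommGroup Γ] [LinearOrder Γ] [IsOrderedAddMonoid Γ]
  {Γ' : Type u'} [AddCommGroup Γ'] [LinearOrder Γ'] [IsOrderedAddMonoid Γ']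
  {K : Type v} [Field K]
  {D : Derivation K (HahnSeries Γ K) (HahnSeries Γ K)} {x : HahnSeries Γ K}
  {Δ : HahnSeries Γ K →ₐ[K] HahnSeries Γ' K} {δ : HahnSeries Γ' K} {s : HahnSeries Γ K}

theorem Reaches.exists_le {A : Set Γ} {β : Γ} {k : ℕ} {n : Γ} (h : Reaches D A β k n) :
    ∃ a ∈ A, a ≤ n + k • β := by
  induction h with
  | start ha => exact ⟨_, ha, by simp⟩
  | @step k p n _ _ hp ih =>
    obtain ⟨a, ha, hle⟩ := ih
    refine ⟨a, ha, hle.trans ?_⟩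
    rw [succ_nsmul', ← add_assoc]
    gcongr

/-- The terms of the Taylor expansion at `s` after the first one are `≺ Δ s`. -/
theorem orderTop_map_lt_orderTop_taylorTerm (hD : IsStronglyLinear (fun s => D s))
    (hΔ : IsStronglyLinear (fun s => Δ s)) (hx : x ≠ 0) (hspec : SpecialCondition D x)
    (hδ : StrictlyDominated δ (Δ x)) (hs : s.support ⊆ taylorGroup D Δ δ) (hs0 : s ≠ 0) {k : ℕ}
    (hk : k ≠ 0) : (Δ s).orderTop < (taylorTerm D Δ δ s k).orderTop := by
  by_contra hle
  rw [not_lt] at hle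
  have hΔs : Δ s ≠ 0 := (map_ne_zero Δ).2 hs0
  obtain ⟨g, hg⟩ : ∃ g : Γ', (taylorTerm D Δ δ s k).orderTop = g := exists_orderTop_eq (by
    intro h0
    rw [h0, HahnSeries.orderTop_zero, top_le_iff] at hle
    exact hΔs (HahnSeries.orderTop_eq_top.1 hle))
  obtain ⟨n, hn, hgn⟩ := exists_mem_support_of_mem_support_taylorTerm hΔ
    (mem_support_of_orderTop_eq hg)
  obtain ⟨hr, a, ha, hga⟩ := reaches_of_mem_support_iterate hD hx hspec s k hn
  obtain ⟨b, hb, hbn⟩ := hr.exists_le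
  set β := growth D x n
  have hε : 0 < (Δ (mono K (-β)) * δ).orderTop := by
    rw [hga]; exact orderTop_map_mono_neg_growth_pos hΔ hx hδ (hs ha)
  -- The factor with exponent n + kβ is ≼ Δ(s), because the chain gives 𝔫𝔟ᵏ ≼ 𝔞 for some 𝔞 in supp
  -- s; the other is infinitesimal as k ≠ 0.
  have h1 : Δ (mono K n) * δ ^ k = Δ (mono K (n + k • β)) * (Δ (mono K (-β)) * δ) ^ k := by
    rw [mul_pow, ← mul_assoc, ← map_pow, ← map_mul, ← mono_nsmul, ← mono_add, smul_neg,
      add_neg_cancel_right]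
  have h2 : (Δ s).orderTop ≤ (Δ (mono K (n + k • β))).orderTop := orderTop_map_le hΔ (by
    rw [orderTop_mono]
    exact (HahnSeries.orderTop_le_of_coeff_ne_zero hb).trans (WithTop.coe_le_coe.2 hbn))
  have h3 : 0 < ((Δ (mono K (-β)) * δ) ^ k).orderTop := by
    obtain ⟨k, rfl⟩ := Nat.exists_eq_succ_of_ne_zero hk
    rw [pow_succ, HahnSeries.orderTop_mul]
    exact hε.trans_le (le_add_of_nonneg_left (orderTop_pow_nonneg hε.le k))
  have h4 : (Δ s).orderTop < (Δ (mono K n) * δ ^ k).orderTop := by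
    rw [h1, HahnSeries.orderTop_mul]
    calc (Δ s).orderTop = (Δ s).orderTop + 0 := (add_zero _).symm
      _ < (Δ s).orderTop + ((Δ (mono K (-β)) * δ) ^ k).orderTop :=
        WithTop.add_lt_add_left (HahnSeries.orderTop_ne_top.2 hΔs) h3
      _ ≤ _ := add_le_add h2 le_rfl
  exact absurd (h4.trans_le (HahnSeries.orderTop_le_of_coeff_ne_zero hgn))
    (not_lt.2 (hg ▸ hle))

theorem taylorDeformation_sub [CharZero K] (hs : IsSummable (taylorTerm D Δ δ s)) :
    taylorDeformation D Δ δ s - Δ s = seriesSum (fun k => taylorTerm D Δ δ s (k + 1)) := by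
  have h : IsSummable (fun k => taylorTerm D Δ δ s k - PowerSeries.coeff k (PowerSeries.C (Δ s))) :=
    hs.sub (isSummable_coeff_C _)
  have h1 := h.seriesSum_comp_of_injective Nat.succ_injective fun i hi => by
    rcases i with - | i
    · rw [taylorTerm_zero, PowerSeries.coeff_zero_C, sub_self]
    · exact absurd ⟨i, rfl⟩ hi
  rw [hs.seriesSum_sub (isSummable_coeff_C _), seriesSum_coeff_C] at h1
  rw [taylorDeformation, ← h1]
  congr 1
  funext k
  rw [coeff_C_eq_zero _ (Nat.succ_ne_zero k), sub_zero]

theorem orderTop_map_lt_orderTop_taylorDeformation_sub [CharZero K]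
    (hD : IsStronglyLinear (fun s => D s))
    (hΔ : IsStronglyLinear (fun s => Δ s)) (hx : x ≠ 0) (hspec : SpecialCondition D x)
    (hδ : StrictlyDominated δ (Δ x)) (hs : s.support ⊆ taylorGroup D Δ δ) (hs0 : s ≠ 0) :
    StrictlyDominated (taylorDeformation D Δ δ s - Δ s) (Δ s) := by
  rw [taylorDeformation_sub (isSummable_taylorTerm hD hΔ hx hspec hδ hs)]
  exact lt_orderTop_seriesSum (HahnSeries.orderTop_ne_top.2 ((map_ne_zero Δ).2 hs0)) fun k =>
    orderTop_map_lt_orderTop_taylorTerm hD hΔ hx hspec hδ hs hs0 k.succ_ne_zero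

/-- The largest monomial occurring in the supports dominates every member and is still ≺ y. If all
members vanish, any sufficiently small monomial serves. -/
theorem exists_dominating {ι : Type*} [Nontrivial Γ] {t : ι → HahnSeries Γ K} (ht : IsSummable t)
    {y : HahnSeries Γ K} (hy : y ≠ 0) (hty : ∀ i, StrictlyDominated (t i) y) :
    ∃ w : HahnSeries Γ K, w ≠ 0 ∧ StrictlyDominated w y ∧ ∀ i, Dominated (t i) w := by
  by_cases hne : (⋃ i, (t i).support).Nonempty
  · refine ⟨mono K (ht.1.isWF.min hne), mono_ne_zero _, ?_, fun i => ?_⟩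
    · obtain ⟨i, hi⟩ := Set.mem_iUnion.1 (ht.1.isWF.min_mem hne)
      rw [StrictlyDominated, orderTop_mono]
      exact (hty i).trans_le (HahnSeries.orderTop_le_of_coeff_ne_zero hi)
    · rw [Dominated, orderTop_mono]
      by_cases hi : t i = 0
      · rw [hi, HahnSeries.orderTop_zero]; exact le_top
      · obtain ⟨g, hg⟩ := exists_orderTop_eq hi
        rw [hg, WithTop.coe_le_coe]
        exact ht.1.isWF.min_le hne (Set.mem_iUnion.2 ⟨i, mem_support_of_orderTop_eq hg⟩)
  · obtain ⟨g, hg⟩ := exists_coe_gt hy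
    refine ⟨mono K g, mono_ne_zero g, ?_, fun i => ?_⟩
    · rw [StrictlyDominated, orderTop_mono]; exact hg g le_rfl
    · have : t i = 0 := HahnSeries.support_eq_empty_iff.1
        (Set.subset_eq_empty (Set.subset_iUnion (fun i => (t i).support) i)
          (Set.not_nonempty_iff_eq_empty.1 hne))
      rw [this, Dominated, HahnSeries.orderTop_zero]; exact le_top

theorem exists_dominating_taylorTerm [Nontrivial Γ'] (hD : IsStronglyLinear (fun s => D s))
    (hΔ : IsStronglyLinear (fun s => Δ s)) (hx : x ≠ 0) (hspec : SpecialCondition D x)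
    (hδ : StrictlyDominated δ (Δ x)) (hs : s.support ⊆ taylorGroup D Δ δ) (hs0 : s ≠ 0) :
    ∃ w : HahnSeries Γ' K, w ≠ 0 ∧ StrictlyDominated w (Δ s) ∧
      ∀ k ≠ 0, Dominated (taylorTerm D Δ δ s k) w := by
  obtain ⟨w, hw0, hw, h⟩ := exists_dominating
    ((isSummable_taylorTerm hD hΔ hx hspec hδ hs).comp_injective Nat.succ_injective)
    ((map_ne_zero Δ).2 hs0) fun k =>
      orderTop_map_lt_orderTop_taylorTerm hD hΔ hx hspec hδ hs hs0 k.succ_ne_zero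
  refine ⟨w, hw0, hw, fun k hk => ?_⟩
  obtain ⟨k, rfl⟩ := Nat.exists_eq_succ_of_ne_zero hk
  exact h k

theorem taylorDeformation_mem_positive [LinearOrder K] [CharZero K]
    (hD : IsStronglyLinear (fun s => D s))
    (hΔ : IsStrongOrderedMorphism Δ) (hx : x ≠ 0) (hspec : SpecialCondition D x)
    (hδ : StrictlyDominated δ (Δ x)) (hs : s.support ⊆ taylorGroup D Δ δ)
    (hpos : s ∈ positive Γ K) : taylorDeformation D Δ δ s ∈ positive Γ' K := by
  have h := add_mem_positive (hΔ.pos s hpos) (orderTop_map_lt_orderTop_taylorDeformation_sub hD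
    hΔ.stronglyLinear hx hspec hδ hs (ne_zero_of_mem_positive hpos))
  rwa [add_sub_cancel] at h

end Dominance

/-! ### Compatibility with analytic functions -/

section Analytic

variable {Γ : Type u} [AddCommGroup Γ] [LinearOrder Γ] [IsOrderedAddMonoid Γ]
  {Γ' : Type u'} [AddCommGroup Γ'] [LinearOrder Γ'] [IsOrderedAddMonoid Γ'] [Nontrivial Γ']
  {K : Type v} [Field K] [LinearOrder K] [IsStrictOrderedRing K]
  {D : Derivation K (HahnSeries Γ K) (HahnSeries Γ K)} {x : HahnSeries Γ K}
  {Δ : HahnSeries Γ K →ₐ[K] HahnSeries Γ' K} {δ : HahnSeries Γ' K}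

theorem taylorDeformation_analytic (hD : IsStronglyLinear (fun s => D s))
    (hΔ : IsStrongOrderedMorphism Δ) (hx : x ≠ 0) (hspec : SpecialCondition D x)
    (hδ : StrictlyDominated δ (Δ x))
    {A : Set (positive (taylorGroup D Δ δ) K → TaylorField D Δ δ)}
    {B : Set (positive Γ' K → HahnSeries Γ' K)} {Ψ : A → B}
    (hA : IsDerivClosedAnalyticClass A) (hB : HasLargeConvergence B)
    (hΨ : ∀ f f' : A, IsDerivativeOf f'.1 f.1 → IsDerivativeOf (Ψ f').1 (Ψ f).1)
    (hΔΨ : ∀ (f : A) (s : positive (taylorGroup D Δ δ) K) (h : Δ (incl s.1) ∈ positive Γ' K),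
      Δ (incl (f.1 s)) = (Ψ f).1 ⟨Δ (incl s.1), h⟩)
    (hder : ∀ f f' : A, IsDerivativeOf f'.1 f.1 → ∀ s : positive (taylorGroup D Δ δ) K,
      D (incl (f.1 s)) = D (incl s.1) * incl (f'.1 s))
    (f : A) (s : positive (taylorGroup D Δ δ) K)
    (h : taylorDeformation D Δ δ (incl s.1) ∈ positive Γ' K) :
    taylorDeformation D Δ δ (incl (f.1 s)) =
      (Ψ f).1 ⟨taylorDeformation D Δ δ (incl s.1), h⟩ := by
  have hsupp := support_incl_subset s.1
  have hpos := incl_mem_positive s.2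
  have hs0 := ne_zero_of_mem_positive hpos
  choose der hderA hder' using hA.deriv_mem
  let F : ℕ → A := fun n => Nat.rec f (fun _ g => ⟨der g.1 g.2, hderA g.1 g.2⟩) n
  have hF : ∀ n, IsDerivativeOf (F (n + 1)).1 (F n).1 := fun n => hder' _ _
  let t : positive Γ' K := ⟨Δ (incl s.1), hΔ.pos _ hpos⟩
  have hP : ∀ P, IsTaylorSeriesAt (Ψ f).1 t P →
      P = PowerSeries.mk fun j => ((j.factorial : K)⁻¹) • Δ (incl ((F j).1 s)) := fun P hP => by
    rw [hP.eq_mk (F := fun n => (Ψ (F n)).1) rfl fun n => hΨ _ _ (hF n)]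
    congr 1
    funext j
    rw [hΔΨ (F j) s t.2]
  obtain ⟨w, hw0, hw, hdom⟩ := exists_dominating_taylorTerm hD hΔ.stronglyLinear hx hspec hδ
    hsupp hs0
  -- Large convergence is used twice: at Δ(s) + w for convergence at the dominating w, and at T(s)
  -- for the value. The Taylor series P and Q obtained coincide by uniqueness of coefficients.
  obtain ⟨P, hPt, hPw, -⟩ := hB _ (Ψ f).2 t
    (show t.1 + w ∈ _ by rw [Set.mem_ofPred_eq, add_sub_cancel_left]; exact hw)
  rw [add_sub_cancel_left] at hPw
  obtain ⟨Q, hQt, -, hmem, hQ⟩ := hB _ (Ψ f).2 t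
    (show taylorDeformation D Δ δ (incl s.1) ∈ _ from
      orderTop_map_lt_orderTop_taylorDeformation_sub hD hΔ.stronglyLinear hx hspec hδ hsupp hs0)
  rw [hP P hPt] at hPw
  rw [hQ, hP Q hQt]
  exact taylorDeformation_eq_evalSeries (a := fun n => incl ((F n).1 s))
    (fun n => hder _ _ (hF n) s) (isSummable_taylorTerm hD hΔ.stronglyLinear hx hspec hδ hsupp)
    hw0 hPw hdom

end Analytic

/-! ### Logarithms -/

section LogSeries

variable {Γ : Type u} [AddCommGroup Γ] [LinearOrder Γ] [IsOrderedAddMonoid Γ]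
  {K : Type v} [Field K]

theorem IsSummable.smul {ι : Type*} {s : ι → HahnSeries Γ K} (h : IsSummable s) (c : ι → K) :
    IsSummable (fun i => c i • s i) :=
  h.of_support_subset fun _ => HahnSeries.support_smul_subset _ _

theorem orderTop_div_pos {t η : HahnSeries Γ K} (ht : t ≠ 0) (hη : StrictlyDominated η t) :
    0 < (η / t).orderTop := by
  have h1 : η.orderTop = t.orderTop + (η / t).orderTop := by
    rw [← HahnSeries.orderTop_mul, mul_div_cancel₀ _ ht]
  by_contra hle
  rw [not_lt] at hle
  refine absurd hη (not_lt.2 ?_)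
  rw [h1]
  exact add_le_of_nonpos_right hle

/-- The series `log (1 + u) = ∑ (-1)ᵏ uᵏ⁺¹ / (k + 1)`. -/
def logOneAdd (u : HahnSeries Γ K) : HahnSeries Γ K :=
  seriesSum (fun k : ℕ => ((-1) ^ k / ((k : K) + 1)) • u ^ (k + 1))

/-- The formal power series `log (1 + X)`. -/
def logPowerSeries (Γ : Type u) [AddCommGroup Γ] [LinearOrder Γ] [IsOrderedAddMonoid Γ]
    (K : Type v) [Field K] : PowerSeries (HahnSeries Γ K) :=
  PowerSeries.X * PowerSeries.mk fun k => HahnSeries.C ((-1) ^ k / ((k : K) + 1))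

theorem coeff_zero_logPowerSeries : PowerSeries.coeff 0 (logPowerSeries Γ K) = 0 := by
  rw [logPowerSeries, PowerSeries.coeff_zero_X_mul]

theorem coeff_succ_logPowerSeries (k : ℕ) : PowerSeries.coeff (k + 1) (logPowerSeries Γ K) =
    HahnSeries.C ((-1) ^ k / ((k : K) + 1)) := by
  rw [logPowerSeries, PowerSeries.coeff_succ_X_mul, PowerSeries.coeff_mk]

theorem C_mul_eq_smul_hahn (c : K) (s : HahnSeries Γ K) : HahnSeries.C c * s = c • s :=
  HahnSeries.C_mul_eq_smul

theorem mem_convergenceSet_logPowerSeries {u : HahnSeries Γ K} (hu : 0 < u.orderTop) :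
    u ∈ convergenceSet (logPowerSeries Γ K) := by
  refine (isSummable_pow hu).of_support_subset fun k => ?_
  rcases k with - | k
  · rw [coeff_zero_logPowerSeries]; simp
  · rw [coeff_succ_logPowerSeries, C_mul_eq_smul_hahn]
    exact HahnSeries.support_smul_subset _ _

theorem evalSeries_logPowerSeries {u : HahnSeries Γ K} (hu : 0 < u.orderTop) :
    evalSeries (logPowerSeries Γ K) u = logOneAdd u := by
  rw [evalSeries, logOneAdd, ← IsSummable.seriesSum_comp_of_injective
    (mem_convergenceSet_logPowerSeries hu) Nat.succ_injective]
  · congr 1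
    funext k
    rw [Nat.succ_eq_add_one, coeff_succ_logPowerSeries, C_mul_eq_smul_hahn]
  · intro i hi
    rcases i with - | i
    · rw [coeff_zero_logPowerSeries, zero_mul]
    · exact absurd ⟨i, rfl⟩ hi

theorem derivative_logPowerSeries_mul [CharZero K] :
    PowerSeries.derivative (HahnSeries Γ K) (logPowerSeries Γ K) * (1 + PowerSeries.X) = 1 := by
  have h : ∀ k, PowerSeries.coeff k (PowerSeries.derivative (HahnSeries Γ K) (logPowerSeries Γ K)) =
      (-1) ^ k := fun k => by
    have hk : (k : K) + 1 ≠ 0 := by exact_mod_cast Nat.succ_ne_zero k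
    rw [PowerSeries.coeff_derivative, coeff_succ_logPowerSeries, ← map_natCast HahnSeries.C,
      ← map_one HahnSeries.C, ← map_add, ← map_mul, div_mul_cancel₀ _ hk, map_pow, map_neg]
  ext1 k
  rw [mul_add, mul_one, map_add, h]
  rcases k with - | k
  · simp
  · rw [PowerSeries.coeff_succ_mul_X, h, pow_succ, PowerSeries.coeff_one,
      if_neg (Nat.succ_ne_zero k)]
    ring

theorem isSummable_coeff_subst {Θ P : PowerSeries (HahnSeries Γ K)}
    (h0 : PowerSeries.constantCoeff Θ = 0) (hΘ : IsSummable fun k => PowerSeries.coeff k Θ)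
    {w : HahnSeries Γ K} (hw : w ≠ 0) (hP : w ∈ convergenceSet P)
    (hdom : ∀ k, Dominated (PowerSeries.coeff k Θ) w) :
    IsSummable (fun k => PowerSeries.coeff k (P.subst Θ)) := by
  simp only [← seriesSum_coeff_subst h0]
  exact ((isSummable_comp_equiv (Equiv.prodComm ℕ ℕ)).2
    (isSummable_coeff_mul_coeff_pow hΘ hw hP hdom)).prod

theorem isSummable_coeff_monomial (n : ℕ) (a : HahnSeries Γ K) :
    IsSummable fun k => PowerSeries.coeff k (PowerSeries.monomial n a) := by
  refine isSummable_of_not_antitone fun k g hk _ hmem => ?_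
  have := hmem (n + 1)
  rw [PowerSeries.coeff_monomial, if_neg (Nat.ne_of_gt (hk.le_apply (x := n + 1)))] at this
  simp at this

theorem seriesSum_coeff_monomial (n : ℕ) (a : HahnSeries Γ K) :
    seriesSum (fun k => PowerSeries.coeff k (PowerSeries.monomial n a)) = a := by
  rw [seriesSum_eq_single n fun k hk => by rw [PowerSeries.coeff_monomial, if_neg hk],
    PowerSeries.coeff_monomial_same]

theorem dominated_coeff_monomial {a w : HahnSeries Γ K} (h : Dominated a w) (n k : ℕ) :
    Dominated (PowerSeries.coeff k (PowerSeries.monomial n a)) w := by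
  rw [PowerSeries.coeff_monomial]
  split_ifs
  · exact h
  · rw [Dominated, HahnSeries.orderTop_zero]; exact le_top

/-- The inner series is (1 + aX)(1 + bX) − 1. Both sides have constant coefficient 0 and the same
derivative, because the formal derivative of log(1 + X) is the inverse of 1 + X. -/
theorem logPowerSeries_subst [CharZero K] (a b : HahnSeries Γ K) :
    (logPowerSeries Γ K).subst (PowerSeries.monomial 1 a + PowerSeries.monomial 1 b +
      PowerSeries.monomial 2 (a * b)) =
    (logPowerSeries Γ K).subst (PowerSeries.monomial 1 a) +
      (logPowerSeries Γ K).subst (PowerSeries.monomial 1 b) := by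
  set P := logPowerSeries Γ K
  set A : PowerSeries (HahnSeries Γ K) := PowerSeries.monomial 1 a with hA
  set B : PowerSeries (HahnSeries Γ K) := PowerSeries.monomial 1 b with hB
  have hAB : (PowerSeries.monomial 2 (a * b) : PowerSeries (HahnSeries Γ K)) = A * B := by
    rw [hA, hB, PowerSeries.monomial_mul_monomial]
  rw [hAB]
  have hA0 : PowerSeries.constantCoeff A = 0 := by
    rw [← PowerSeries.coeff_zero_eq_constantCoeff_apply, hA, PowerSeries.coeff_monomial,
      if_neg zero_ne_one]
  have hB0 : PowerSeries.constantCoeff B = 0 := by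
    rw [← PowerSeries.coeff_zero_eq_constantCoeff_apply, hB, PowerSeries.coeff_monomial,
      if_neg zero_ne_one]
  have hC0 : PowerSeries.constantCoeff (A + B + A * B) = 0 := by
    rw [map_add, map_add, map_mul, hA0, hB0, zero_add, zero_mul, zero_add]
  have hinv : ∀ T : PowerSeries (HahnSeries Γ K), PowerSeries.HasSubst T →
      (PowerSeries.derivative (HahnSeries Γ K) P).subst T * (1 + T) = 1 := fun T hT => by
    have h := congrArg (PowerSeries.subst T) (derivative_logPowerSeries_mul (Γ := Γ) (K := K))
    rw [← PowerSeries.coe_substAlgHom hT] at h ⊢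
    rw [map_mul, map_add, map_one, PowerSeries.coe_substAlgHom hT, PowerSeries.subst_X hT] at h
    rw [PowerSeries.coe_substAlgHom hT]
    exact h
  have hconst : ∀ T : PowerSeries (HahnSeries Γ K), PowerSeries.constantCoeff T = 0 →
      PowerSeries.constantCoeff (P.subst T) = 0 := fun T hT => by
    rw [← PowerSeries.coeff_zero_eq_constantCoeff_apply, ← seriesSum_coeff_subst hT,
      seriesSum_eq_single 0 fun j hj => by
        rw [PowerSeries.coeff_zero_eq_constantCoeff_apply, map_pow, hT, zero_pow hj, mul_zero],
      coeff_zero_logPowerSeries, zero_mul]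
  have hsA := PowerSeries.HasSubst.of_constantCoeff_zero' hA0
  have hsB := PowerSeries.HasSubst.of_constantCoeff_zero' hB0
  have hsC := PowerSeries.HasSubst.of_constantCoeff_zero' hC0
  refine PowerSeries.derivative.ext ?_ ?_
  · rw [map_add, PowerSeries.derivative_subst hsA, PowerSeries.derivative_subst hsB,
      PowerSeries.derivative_subst hsC, map_add, map_add, Derivation.leibniz, smul_eq_mul,
      smul_eq_mul]
    have h1 := hinv A hsA
    have h2 := hinv B hsB
    have h3 := hinv _ hsC
    generalize (PowerSeries.derivative (HahnSeries Γ K) P).subst A = p at h1 ⊢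
    generalize (PowerSeries.derivative (HahnSeries Γ K) P).subst B = q at h2 ⊢
    generalize (PowerSeries.derivative (HahnSeries Γ K) P).subst (A + B + A * B) = r at h3 ⊢
    -- Here p, q, r are inverses of 1 + A, 1 + B and (1 + A)(1 + B).
    have h4 : r = p * q := by
      linear_combination (-r) * h1 - r * p * (1 + A) * h2 + p * q * h3
    rw [h4]
    linear_combination (q * PowerSeries.derivative (HahnSeries Γ K) B) * h1 +
      (p * PowerSeries.derivative (HahnSeries Γ K) A) * h2
  · rw [map_add, hconst _ hA0, hconst _ hB0, hconst _ hC0, add_zero]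

theorem logOneAdd_seriesSum {Θ : PowerSeries (HahnSeries Γ K)}
    (h0 : PowerSeries.constantCoeff Θ = 0) (hΘ : IsSummable fun k => PowerSeries.coeff k Θ)
    {w : HahnSeries Γ K} (hw0 : w ≠ 0) (hw : 0 < w.orderTop)
    (hdom : ∀ k, Dominated (PowerSeries.coeff k Θ) w) :
    logOneAdd (seriesSum fun k => PowerSeries.coeff k Θ) =
      seriesSum (fun k => PowerSeries.coeff k ((logPowerSeries Γ K).subst Θ)) := by
  rw [← evalSeries_seriesSum h0 hΘ hw0 (mem_convergenceSet_logPowerSeries hw) hdom,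
    evalSeries_logPowerSeries (hw.trans_le (le_orderTop_seriesSum hdom))]

variable [Nontrivial Γ]

/-- The formal identity evaluated at X = 1, with a common infinitesimal bound w for a, b and ab. -/
theorem logOneAdd_add_add_mul [CharZero K] {a b : HahnSeries Γ K} (ha : 0 < a.orderTop)
    (hb : 0 < b.orderTop) : logOneAdd (a + b + a * b) = logOneAdd a + logOneAdd b := by
  obtain ⟨w, hw0, hw, hdom⟩ := exists_dominating (isSummable_of_finite ![a, b]) one_ne_zero
    (fun i => by
      rw [StrictlyDominated, HahnSeries.orderTop_one]
      fin_cases i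
      exacts [ha, hb])
  rw [StrictlyDominated, HahnSeries.orderTop_one] at hw
  have haw : Dominated a w := hdom 0
  have hbw : Dominated b w := hdom 1
  have hab : Dominated (a * b) w := by
    rw [Dominated, HahnSeries.orderTop_mul]
    exact haw.trans (le_add_of_nonneg_right hb.le)
  have h0 : ∀ (c : HahnSeries Γ K) (n : ℕ), PowerSeries.constantCoeff
      (PowerSeries.monomial (n + 1) c : PowerSeries (HahnSeries Γ K)) = 0 := fun c n => by
    rw [← PowerSeries.coeff_zero_eq_constantCoeff_apply, PowerSeries.coeff_monomial,
      if_neg n.succ_ne_zero.symm]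
  have hP := mem_convergenceSet_logPowerSeries hw
  have hsum := fun (c : HahnSeries Γ K) (hc : Dominated c w) =>
    isSummable_coeff_subst (h0 c 0) (isSummable_coeff_monomial 1 c) hw0 hP
      (dominated_coeff_monomial hc 1)
  have hlog := fun (c : HahnSeries Γ K) (hc : Dominated c w) =>
    logOneAdd_seriesSum (h0 c 0) (isSummable_coeff_monomial 1 c) hw0 hw
      (dominated_coeff_monomial hc 1)
  have hΘ1 := (isSummable_coeff_monomial 1 a).add (isSummable_coeff_monomial 1 b)
  have hΘ := hΘ1.add (isSummable_coeff_monomial 2 (a * b))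
  have h := logOneAdd_seriesSum (Θ := PowerSeries.monomial 1 a + PowerSeries.monomial 1 b +
      PowerSeries.monomial 2 (a * b)) (by rw [map_add, map_add, h0, h0, h0, add_zero, add_zero])
    (by simpa only [map_add] using hΘ) hw0 hw fun k => by
      rw [map_add, map_add]
      exact (le_min ((le_min (dominated_coeff_monomial haw 1 k)
        (dominated_coeff_monomial hbw 1 k)).trans HahnSeries.min_orderTop_le_orderTop_add)
        (dominated_coeff_monomial hab 2 k)).trans HahnSeries.min_orderTop_le_orderTop_add
  have ha' := hlog a haw
  have hb' := hlog b hbw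
  simp only [seriesSum_coeff_monomial] at ha' hb'
  rw [ha', hb', ← (hsum a haw).seriesSum_add (hsum b hbw)]
  simp only [map_add, logPowerSeries_subst] at h
  rw [hΘ1.seriesSum_add (isSummable_coeff_monomial 2 (a * b)),
    (isSummable_coeff_monomial 1 a).seriesSum_add (isSummable_coeff_monomial 1 b)] at h
  simpa only [seriesSum_coeff_monomial] using h

end LogSeries

/-! ### The logarithm on positive series and its derivative -/

section HahnLog

variable {Γ : Type u} [AddCommGroup Γ] [LinearOrder Γ] [IsOrderedAddMonoid Γ]
  {K : Type v} [Field K] [LinearOrder K] {logK : K → K} {ℓ : Γ →+ HahnSeries Γ K}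

theorem hahnLog_eq (s : HahnSeries Γ K) : hahnLog logK ℓ s =
    ℓ s.order + HahnSeries.C (logK s.leadingCoeff) +
      logOneAdd (s / HahnSeries.single s.order s.leadingCoeff - 1) := rfl

theorem orderTop_div_leadingTerm_sub_one_pos {s : HahnSeries Γ K} (hs : s ≠ 0) :
    0 < (s / HahnSeries.single s.order s.leadingCoeff - 1).orderTop := by
  rw [HahnSeries.orderTop_self_sub_one_pos_iff, div_eq_mul_inv, HahnSeries.inv_single]
  have hc : s.leadingCoeff⁻¹ ≠ 0 := inv_ne_zero (HahnSeries.leadingCoeff_ne_zero.2 hs)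
  constructor
  · rw [HahnSeries.orderTop_mul, HahnSeries.orderTop_single hc,
      ← HahnSeries.order_eq_orderTop_of_ne_zero hs, ← WithTop.coe_add, add_neg_cancel]
    rfl
  · rw [HahnSeries.leadingCoeff_mul, HahnSeries.leadingCoeff_of_single, mul_inv_cancel₀]
    exact HahnSeries.leadingCoeff_ne_zero.2 hs

/-- Adding η ≺ t leaves the leading term unchanged, so only the factor 1 + η/t contributes, through
the functional equation of log(1 + ·). -/
theorem hahnLog_add [Nontrivial Γ] [CharZero K] {t η : HahnSeries Γ K} (ht : t ≠ 0)
    (hη : StrictlyDominated η t) :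
    hahnLog logK ℓ (t + η) = hahnLog logK ℓ t + logOneAdd (η / t) := by
  have hc : (t + η).leadingCoeff = t.leadingCoeff := HahnSeries.leadingCoeff_add_eq_left hη
  have ht' : t + η ≠ 0 := by
    rw [← HahnSeries.leadingCoeff_ne_zero, hc]
    exact HahnSeries.leadingCoeff_ne_zero.2 ht
  have ho : (t + η).order = t.order := by
    rw [← WithTop.coe_inj, HahnSeries.order_eq_orderTop_of_ne_zero ht,
      HahnSeries.order_eq_orderTop_of_ne_zero ht', HahnSeries.orderTop_add_eq_left hη]
  have hu := orderTop_div_pos ht hη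
  have hl : (HahnSeries.single t.order t.leadingCoeff : HahnSeries Γ K) ≠ 0 :=
    HahnSeries.single_ne_zero (HahnSeries.leadingCoeff_ne_zero.2 ht)
  rw [hahnLog_eq, hahnLog_eq, ho, hc, add_assoc _ (logOneAdd _),
    ← logOneAdd_add_add_mul (orderTop_div_leadingTerm_sub_one_pos ht) hu]
  congr 2
  field_simp
  ring

variable {D : Derivation K (HahnSeries Γ K) (HahnSeries Γ K)}

theorem derivation_C (c : K) : D (HahnSeries.C c) = 0 := by
  rw [← algebraMap_hahn, Derivation.map_algebraMap]

theorem seriesSum_neg_pow {u : HahnSeries Γ K} (hu : 0 < u.orderTop) :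
    (1 + u) * seriesSum (fun k : ℕ => (-u) ^ k) = 1 := by
  have hu' : 0 < (-u).orderTop := by rwa [HahnSeries.orderTop_neg]
  have h := HahnSeries.SummableFamily.one_sub_self_mul_hsum_powers hu'
  rw [← seriesSum_coe, HahnSeries.SummableFamily.coe_powers hu', sub_neg_eq_add] at h
  exact h

theorem derivation_logOneAdd [CharZero K] (hD : IsStronglyLinear (fun s => D s))
    {u : HahnSeries Γ K} (hu : 0 < u.orderTop) : D (logOneAdd u) * (1 + u) = D u := by
  have hs : IsSummable (fun k : ℕ => ((-1) ^ k / ((k : K) + 1)) • u ^ (k + 1)) :=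
    ((isSummable_pow hu).comp_injective Nat.succ_injective).smul _
  have hu' : 0 < (-u).orderTop := by rwa [HahnSeries.orderTop_neg]
  have h : ∀ k : ℕ, D (((-1) ^ k / ((k : K) + 1)) • u ^ (k + 1)) = D u * (-u) ^ k := fun k => by
    have hk : (k : K) + 1 ≠ 0 := by exact_mod_cast Nat.succ_ne_zero k
    rw [Derivation.map_smul, Derivation.leibniz_pow, Nat.add_sub_cancel, ← Nat.cast_smul_eq_nsmul K,
      smul_smul, Nat.cast_succ, div_mul_cancel₀ _ hk, smul_eq_mul, neg_pow u, mul_comm (D u),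
      ← map_one (algebraMap K (HahnSeries Γ K)), ← map_neg, ← map_pow, mul_assoc, Algebra.smul_def]
  rw [logOneAdd, (hD.map_sum_nat hs).2]
  simp only [h]
  rw [(isSummable_pow hu').seriesSum_mul_left, mul_assoc, mul_comm _ (1 + u),
    seriesSum_neg_pow hu, mul_one]

theorem derivation_hahnLog [CharZero K] (hD : IsStronglyLinear (fun s => D s))
    (hℓ : ∀ γ, D (ℓ γ) = logDer D γ) {s : HahnSeries Γ K} (hs : s ≠ 0) :
    D (hahnLog logK ℓ s) = D s * s⁻¹ := by
  have hc := HahnSeries.leadingCoeff_ne_zero.2 hs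
  have hl : (HahnSeries.single s.order s.leadingCoeff : HahnSeries Γ K) ≠ 0 :=
    HahnSeries.single_ne_zero hc
  have hε := orderTop_div_leadingTerm_sub_one_pos hs
  have h1 := derivation_logOneAdd hD hε
  have hDl : D (HahnSeries.single s.order s.leadingCoeff) =
      HahnSeries.single s.order s.leadingCoeff * logDer D s.order := by
    have h2 : (HahnSeries.single s.order s.leadingCoeff : HahnSeries Γ K) =
        s.leadingCoeff • mono K s.order := by
      rw [mono, ← HahnSeries.single_zero_mul_eq_smul, HahnSeries.single_mul_single, zero_add,
        mul_one]
    rw [h2, Derivation.map_smul, derivation_mono, smul_mul_assoc]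
  rw [map_sub, Derivation.map_one_eq_zero, sub_zero, Derivation.leibniz_div, smul_eq_mul,
    smul_eq_mul, smul_eq_mul, hDl, add_sub_cancel] at h1
  rw [hahnLog_eq, map_add, map_add, hℓ, derivation_C, add_zero]
  generalize (HahnSeries.single s.order s.leadingCoeff : HahnSeries Γ K) = l at *
  generalize D (logOneAdd _) = y at *
  field_simp at h1 ⊢
  linear_combination h1

end HahnLog

/-! ### Compatibility with logarithms -/

section LogCompatible

variable {Γ : Type u} [AddCommGroup Γ] [LinearOrder Γ] [IsOrderedAddMonoid Γ]
  {Γ' : Type u'} [AddCommGroup Γ'] [LinearOrder Γ'] [IsOrderedAddMonoid Γ'] [Nontrivial Γ']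
  {K : Type v} [Field K]

/-- The logarithm of `s` and its derivatives `(-1)ⁿ n! s⁻ⁿ⁻¹`, for a given value of the
logarithm. -/
def logDerivatives (l s : HahnSeries Γ K) : ℕ → HahnSeries Γ K
  | 0 => l
  | n + 1 => ((-1) ^ n * (n.factorial : K)) • s⁻¹ ^ (n + 1)

theorem derivation_logDerivatives {D : Derivation K (HahnSeries Γ K) (HahnSeries Γ K)}
    {l s : HahnSeries Γ K} (hl : D l = D s * s⁻¹) (n : ℕ) :
    D (logDerivatives l s n) = D s * logDerivatives l s (n + 1) := by
  rcases n with - | n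
  · simp [logDerivatives, hl]
  · rw [logDerivatives, logDerivatives, Derivation.map_smul, Derivation.leibniz_pow,
      Derivation.leibniz_inv, Nat.add_sub_cancel, smul_eq_mul, smul_eq_mul,
      ← Nat.cast_smul_eq_nsmul K, smul_smul, mul_smul_comm, Nat.factorial_succ, Nat.cast_mul,
      show s⁻¹ ^ (n) * (-s⁻¹ ^ 2 * D s) = -(D s * s⁻¹ ^ (n + 1 + 1)) by
        ring, smul_neg, ← neg_smul]
    congr 1
    ring

theorem evalSeries_log {P : PowerSeries (HahnSeries Γ' K)} {l t η : HahnSeries Γ' K}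
    (ht : t ≠ 0) (hη : StrictlyDominated η t) (h0 : PowerSeries.coeff 0 P = l)
    (hP : ∀ k : ℕ, PowerSeries.coeff (k + 1) P = ((-1) ^ k / ((k : K) + 1)) • t⁻¹ ^ (k + 1)) :
    η ∈ convergenceSet P ∧ evalSeries P η = l + logOneAdd (η / t) := by
  have hu := orderTop_div_pos ht hη
  have h : ∀ k, PowerSeries.coeff k P * η ^ k = PowerSeries.coeff k (PowerSeries.C l) +
      PowerSeries.coeff k (logPowerSeries Γ' K) * (η / t) ^ k := fun k => by
    rcases k with - | k
    · rw [h0, PowerSeries.coeff_zero_C, coeff_zero_logPowerSeries, pow_zero, mul_one, zero_mul,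
        add_zero]
    · rw [hP, coeff_C_eq_zero _ k.succ_ne_zero, coeff_succ_logPowerSeries, C_mul_eq_smul_hahn,
        zero_add, smul_mul_assoc, ← mul_pow, div_eq_mul_inv η, mul_comm η]
  have hs := mem_convergenceSet_logPowerSeries hu
  simp only [convergenceSet, evalSeries, Set.mem_ofPred_eq, h]
  refine ⟨(isSummable_coeff_C l).add hs, ?_⟩
  rw [(isSummable_coeff_C l).seriesSum_add hs, seriesSum_coeff_C, ← evalSeries_logPowerSeries hu,
    evalSeries]

/-- Since log has the explicit derivatives (−1)ⁿ n! s⁻ⁿ⁻¹, the formal Taylor formula applies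
directly. The outer series converges at every η ≺ Δ(s), with value log(Δ(s) + η). -/
theorem taylorDeformation_hahnLog [LinearOrder K] [CharZero K]
    {D : Derivation K (HahnSeries Γ K) (HahnSeries Γ K)} {x s : HahnSeries Γ K}
    {Δ : HahnSeries Γ K →ₐ[K] HahnSeries Γ' K} {δ : HahnSeries Γ' K}
    {logK : K → K} {ℓ : Γ →+ HahnSeries Γ K} {ℓ' : Γ' →+ HahnSeries Γ' K}
    (hD : IsStronglyLinear (fun s => D s)) (hℓ : ∀ γ, D (ℓ γ) = logDer D γ)
    (hΔ : IsStronglyLinear (fun s => Δ s)) (hx : x ≠ 0) (hspec : SpecialCondition D x)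
    (hδ : StrictlyDominated δ (Δ x)) (hs : s.support ⊆ taylorGroup D Δ δ) (hs0 : s ≠ 0)
    (hlog : Δ (hahnLog logK ℓ s) = hahnLog logK ℓ' (Δ s)) :
    taylorDeformation D Δ δ (hahnLog logK ℓ s) =
      hahnLog logK ℓ' (taylorDeformation D Δ δ s) := by
  have ht0 : Δ s ≠ 0 := (map_ne_zero Δ).2 hs0
  obtain ⟨w, hw0, hw, hdom⟩ := exists_dominating_taylorTerm hD hΔ hx hspec hδ hs hs0
  have hη := orderTop_map_lt_orderTop_taylorDeformation_sub hD hΔ hx hspec hδ hs hs0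
  set a := logDerivatives (hahnLog logK ℓ s) s
  have h0 : PowerSeries.coeff 0 (PowerSeries.mk fun j => ((j.factorial : K)⁻¹) • Δ (a j)) =
      hahnLog logK ℓ' (Δ s) := by
    rw [PowerSeries.coeff_mk, Nat.factorial_zero, Nat.cast_one, inv_one, one_smul, ← hlog]
    rfl
  have hP : ∀ k : ℕ, PowerSeries.coeff (k + 1)
      (PowerSeries.mk fun j => ((j.factorial : K)⁻¹) • Δ (a j)) =
      ((-1) ^ k / ((k : K) + 1)) • (Δ s)⁻¹ ^ (k + 1) := fun k => by
    have hk : (k : K) + 1 ≠ 0 := by exact_mod_cast Nat.succ_ne_zero k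
    have hf : (k.factorial : K) ≠ 0 := by exact_mod_cast k.factorial_ne_zero
    rw [PowerSeries.coeff_mk]
    simp only [a, logDerivatives]
    rw [hΔ.isLinear.map_smul, map_pow, map_inv₀, smul_smul, Nat.factorial_succ, Nat.cast_mul, Nat.cast_succ]
    congr 1
    field_simp
  have h := taylorDeformation_eq_evalSeries (a := a)
    (derivation_logDerivatives (derivation_hahnLog hD hℓ hs0))
    (isSummable_taylorTerm hD hΔ hx hspec hδ hs) hw0 (evalSeries_log ht0 hw h0 hP).1 hdom
  rw [(evalSeries_log ht0 hη h0 hP).2, ← hahnLog_add ht0 hη, add_sub_cancel] at h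
  exact h

end LogCompatible

end TaylorDef

end

theorem mainTheorem4
    {K : Type v} [Field K] [LinearOrder K] [IsStrictOrderedRing K]
    {Γ : Type u} [AddCommGroup Γ] [LinearOrder Γ] [IsOrderedAddMonoid Γ] [Nontrivial Γ]
    {Γ' : Type u'} [AddCommGroup Γ'] [LinearOrder Γ'] [IsOrderedAddMonoid Γ'] [Nontrivial Γ']
    (ℓ : Γ →+ HahnSeries Γ K)
    (D : Derivation K (HahnSeries Γ K) (HahnSeries Γ K))
    (hS : TaylorDef.IsDiffPreLogHahnField ℓ D)
    (Δ : HahnSeries Γ K →ₐ[K] HahnSeries Γ' K)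
    (hΔ : TaylorDef.IsStrongOrderedMorphism Δ)
    (x : HahnSeries Γ K) (hx : x ≠ 0) (hspec : TaylorDef.SpecialCondition D x)
    (δ : HahnSeries Γ' K) (hδ : TaylorDef.StrictlyDominated δ (Δ x)) :
    -- Taylor deformations satisfy the same commutation relations with analytic functions
    (∀ (A : Set (TaylorDef.positive (TaylorDef.taylorGroup D Δ δ) K →
            TaylorDef.TaylorField D Δ δ))
        (B : Set (TaylorDef.positive Γ' K → HahnSeries Γ' K))
        (Ψ : A → B),
      TaylorDef.IsDerivClosedAnalyticClass A →
      TaylorDef.IsDerivClosedAnalyticClass B →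
      TaylorDef.HasLargeConvergence A →
      TaylorDef.HasLargeConvergence B →
      (∀ f f' : A, TaylorDef.IsDerivativeOf f'.1 f.1 →
        TaylorDef.IsDerivativeOf (Ψ f').1 (Ψ f).1) →
      (∀ (f : A) (s : TaylorDef.positive (TaylorDef.taylorGroup D Δ δ) K)
          (h : Δ (TaylorDef.incl s.1) ∈ TaylorDef.positive Γ' K),
        Δ (TaylorDef.incl (f.1 s)) = (Ψ f).1 ⟨Δ (TaylorDef.incl s.1), h⟩) →
      (∀ f f' : A, TaylorDef.IsDerivativeOf f'.1 f.1 →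
        ∀ s : TaylorDef.positive (TaylorDef.taylorGroup D Δ δ) K,
          D (TaylorDef.incl (f.1 s)) = D (TaylorDef.incl s.1) * TaylorDef.incl (f'.1 s)) →
      ∀ (f : A) (s : TaylorDef.positive (TaylorDef.taylorGroup D Δ δ) K),
        TaylorDef.IsSummable (TaylorDef.taylorTerm D Δ δ (TaylorDef.incl s.1)) ∧
        TaylorDef.IsSummable (TaylorDef.taylorTerm D Δ δ (TaylorDef.incl (f.1 s))) ∧
        ∃ h : TaylorDef.taylorDeformation D Δ δ (TaylorDef.incl s.1) ∈ TaylorDef.positive Γ' K,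
          TaylorDef.taylorDeformation D Δ δ (TaylorDef.incl (f.1 s)) =
            (Ψ f).1 ⟨TaylorDef.taylorDeformation D Δ δ (TaylorDef.incl s.1), h⟩) ∧
    -- in particular, Taylor deformations of log-compatible maps are log-compatible
    (∀ (logK : K → K) (ℓ' : Γ' →+ HahnSeries Γ' K),
      TaylorDef.IsLogOn logK →
      TaylorDef.IsPreLog ℓ' →
      (∀ s ∈ TaylorDef.positive (TaylorDef.taylorGroup D Δ δ) K,
        ∃ t : TaylorDef.TaylorField D Δ δ,
          TaylorDef.hahnLog logK ℓ (TaylorDef.incl s) = TaylorDef.incl t) →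
      (∀ s ∈ TaylorDef.positive (TaylorDef.taylorGroup D Δ δ) K,
        Δ (TaylorDef.hahnLog logK ℓ (TaylorDef.incl s)) =
          TaylorDef.hahnLog logK ℓ' (Δ (TaylorDef.incl s))) →
      ∀ s ∈ TaylorDef.positive (TaylorDef.taylorGroup D Δ δ) K,
        TaylorDef.IsSummable (TaylorDef.taylorTerm D Δ δ (TaylorDef.incl s)) ∧
        TaylorDef.IsSummable
          (TaylorDef.taylorTerm D Δ δ (TaylorDef.hahnLog logK ℓ (TaylorDef.incl s))) ∧
        TaylorDef.taylorDeformation D Δ δ (TaylorDef.incl s) ∈ TaylorDef.positive Γ' K ∧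
        TaylorDef.taylorDeformation D Δ δ (TaylorDef.hahnLog logK ℓ (TaylorDef.incl s)) =
          TaylorDef.hahnLog logK ℓ' (TaylorDef.taylorDeformation D Δ δ (TaylorDef.incl s))) := by
  have hD := hS.stronglyLinear
  have hsl := hΔ.stronglyLinear
  refine ⟨fun A B Ψ hA _ _ hB hΨ hΔΨ hder f s => ?_, fun logK ℓ' _ _ hlogS hlog s hs => ?_⟩
  · have hpos := TaylorDef.taylorDeformation_mem_positive hD hΔ hx hspec hδ
      (TaylorDef.support_incl_subset s.1) (TaylorDef.incl_mem_positive s.2)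
    exact ⟨TaylorDef.isSummable_taylorTerm hD hsl hx hspec hδ (TaylorDef.support_incl_subset _),
      TaylorDef.isSummable_taylorTerm hD hsl hx hspec hδ (TaylorDef.support_incl_subset _), hpos,
      TaylorDef.taylorDeformation_analytic hD hΔ hx hspec hδ hA hB hΨ hΔΨ hder f s hpos⟩
  · have hsupp := TaylorDef.support_incl_subset s
    have hpos := TaylorDef.incl_mem_positive hs
    obtain ⟨t, ht⟩ := hlogS s hs
    refine ⟨TaylorDef.isSummable_taylorTerm hD hsl hx hspec hδ hsupp, ?_,
      TaylorDef.taylorDeformation_mem_positive hD hΔ hx hspec hδ hsupp hpos,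
      TaylorDef.taylorDeformation_hahnLog hD hS.der_log hsl hx hspec hδ hsupp
        (TaylorDef.ne_zero_of_mem_positive hpos) (hlog s hs)⟩
    -- Closure under log is what puts the support of log s in the group on which Taylor expansions
    -- are summable.
    rw [ht]
    exact TaylorDef.isSummable_taylorTerm hD hsl hx hspec hδ (TaylorDef.support_incl_subset t)
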